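/- Let $L=\{L(B): B\in\mathcal B(\mathbb R^2),\ \mathrm{Leb}(B)<\infty\}$ be a homogeneous Lévy basis on $\mathbb R^2$ with characteristic triplet $(\gamma,b,\nu)$ ($b\ge0$, $\nu$ a Lévy measure). That is, the $L(B)$ are infinitely divisible real random variables on one probability space, $L(B)$ and $L(C)$ are independent whenever $B\cap C=\emptyset$, $L$ is almost surely $\sigma$-additive (for every sequence of disjoint Borel sets $B_i$ whose union has finite measure, $L(\bigcup_iB_i)=\sum_iL(B_i)$ a.s.), and $\mathbb E[e^{izL(B)}]=e^{\mathrm{Leb}(B)\psi(z)}$ for all $z\in\mathbb R$, where $$\psi(z)=i\gamma z-\tfrac12b^2z^2+\int_{\mathbb R\setminus\{0\}}\bigl(e^{izx}-1-izx\mathbf 1_{|x|\le1}\bigr)\,\nu(\mathrm dx).$$ Let $L'$ be the Lévy seed of $L$, i.e. a random variable with $\mathbb E[e^{izL'}]=e^{\psi(z)}$, and suppose that $\mathrm{Var}(L')=1$ and $\mathbb E|L'|^4<\infty$. Let $a:[0,\infty)\to[0,\infty)$ be continuous, non-increasing and integrable, put $A=\{(r,y): r\le0,\ 0\le y\le a(-r)\}$,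 and let $X_t=L(A+(t,0))$, $t\in\mathbb R$, be the trawl process with trawl function $a$. Let $\Delta_n>0$ with $\Delta_n\to0$ and $n\Delta_n\to\infty$. From the observations $X_0,X_{\Delta_n},\dots,X_{(n-1)\Delta_n}$ form $\bar X_n=\frac1n\sum_{k=0}^{n-1}X_{k\Delta_n}$ and $$\hat\varGamma_l=\frac1n\sum_{k=0}^{n-1-l}(X_{(l+k)\Delta_n}-\bar X_n)(X_{k\Delta_n}-\bar X_n),$$ an empty sum being $0$, and define $$\hat a(t)=-\frac{\hat\varGamma_{l+1}-\hat\varGamma_l}{\Delta_n}\quad\text{for }t>0,\text{ where } l\Delta_n\le t<(l+1)\Delta_n,\qquad \hat a(0)=\frac1{2n\Delta_n}\sum_{k=0}^{n-2}(X_{(k+1)\Delta_n}-X_{k\Delta_n})^2.$$ Then, for every $t\ge0$, $\hat a(t)\to a(t)$ in probability as $n\to\infty$. -/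

import Mathlib

open MeasureTheory ProbabilityTheory Filter Topology Set
open scoped ENNReal Function

noncomputable section

/-- A probability law on `ℝ` is infinitely divisible if for every `m ≥ 1` it is the law of a sum
of `m` i.i.d. random variables. -/
def IsInfDivLaw (ρ : Measure ℝ) : Prop :=
  ∀ m : ℕ, 1 ≤ m → ∃ κ : Measure ℝ, IsProbabilityMeasure κ ∧
    (Measure.pi (fun _ : Fin m => κ)).map (fun x => ∑ i, x i) = ρ

/-- A Lévy basis with respect to `μ` on the probability space `(Ω, P)`: an infinitely divisible,
independently scattered, almost surely `σ`-additive family of random variables `L A`, indexed by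
the measurable sets `A` with `μ A < ∞` (the values of `L` on other sets are irrelevant).
As the random series `∑ i, L (A i)` need not converge absolutely, its sum is the
limit of its partial sums. -/
structure IsLevyBasis {E Ω : Type*} [MeasurableSpace E] [MeasurableSpace Ω]
    (L : Set E → Ω → ℝ) (μ : Measure E) (P : Measure Ω) : Prop where
  measurable : ∀ A, MeasurableSet A → μ A < ∞ → Measurable (L A)
  infDiv : ∀ A, MeasurableSet A → μ A < ∞ → IsInfDivLaw (P.map (L A))
  indep : ∀ A B, MeasurableSet A → MeasurableSet B → μ A < ∞ → μ B < ∞ → Disjoint A B →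
    IndepFun (L A) (L B) P
  sigmaAdditive : ∀ A : ℕ → Set E, (∀ i, MeasurableSet (A i)) → Pairwise (Disjoint on A) →
    μ (⋃ i, A i) < ∞ →
    ∀ᵐ ω ∂P, Tendsto (fun N : ℕ => ∑ i ∈ Finset.range N, L (A i) ω) atTop
      (𝓝 (L (⋃ i, A i) ω))

/-- A Lévy measure on `ℝ`. -/
structure IsLevyMeasure (ν : Measure ℝ) : Prop where
  zero : ν {0} = 0
  lintegral_lt_top : ∫⁻ x in {0}ᶜ, ENNReal.ofReal (min 1 (|x| ^ 2)) ∂ν < ∞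

/-- The characteristic exponent of the triplet `(γ, b, ν)`:
`ψ(z) = iγz - b²z²/2 + ∫_{ℝ \ {0}} (e^{izx} - 1 - izx 1_{|x| ≤ 1}) ν(dx)`. -/
def levyExponent (γ b : ℝ) (ν : Measure ℝ) (z : ℝ) : ℂ :=
  Complex.I * γ * z - (1 / 2 : ℂ) * (b : ℂ) ^ 2 * (z : ℂ) ^ 2 +
    ∫ x in {0}ᶜ, (Complex.exp (Complex.I * z * x) - 1
      - Complex.I * z * x * (if |x| ≤ 1 then 1 else 0)) ∂ν

/-- A homogeneous Lévy basis (one whose control measure is the Lebesgue measure of the underlying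
space) with characteristic triplet `(γ, b, ν)`: `E[exp(iz L(A))] = exp(Leb(A) ψ(z))`. -/
structure IsHomogeneousLevyBasis {E Ω : Type*} [MeasureSpace E] [MeasurableSpace Ω]
    (L : Set E → Ω → ℝ) (P : Measure Ω) (γ b : ℝ) (ν : Measure ℝ) : Prop where
  isLevyBasis : IsLevyBasis L (volume : Measure E) P
  nonneg : 0 ≤ b
  isLevyMeasure : IsLevyMeasure ν
  charFun_eq : ∀ A : Set E, MeasurableSet A → volume A < ∞ → ∀ z : ℝ,
    charFun (P.map (L A)) z = Complex.exp (((volume A).toReal : ℂ) * levyExponent γ b ν z)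

/-- `S` is a Lévy seed for the triplet `(γ, b, ν)`: a random variable whose law is the infinitely
divisible law with this triplet. -/
structure IsLevySeed {Ω : Type*} [MeasurableSpace Ω] (S : Ω → ℝ) (P : Measure Ω)
    (γ b : ℝ) (ν : Measure ℝ) : Prop where
  measurable : Measurable S
  charFun_eq : ∀ z : ℝ, charFun (P.map S) z = Complex.exp (levyExponent γ b ν z)

/-- A trawl function `a : [0, ∞) → [0, ∞)`: continuous, non-increasing and integrable. (The values
of `a` at negative arguments are irrelevant.) -/
structure IsTrawlFunction (a : ℝ → ℝ) : Prop where
  nonneg : ∀ s, 0 ≤ s → 0 ≤ a s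
  continuousOn : ContinuousOn a (Ici 0)
  antitoneOn : AntitoneOn a (Ici 0)
  integrableOn : IntegrableOn a (Ici 0)

/-- The trawl set `A = {(r, y) : r ≤ 0, 0 ≤ y ≤ a(-r)}`. -/
def trawlSet (a : ℝ → ℝ) : Set (ℝ × ℝ) :=
  {p | p.1 ≤ 0 ∧ 0 ≤ p.2 ∧ p.2 ≤ a (-p.1)}

/-- The trawl process `X_t = L(A_t)` with `A_t = A + (t, 0)`. -/
def trawlProcess {Ω : Type*} (L : Set (ℝ × ℝ) → Ω → ℝ) (a : ℝ → ℝ) (t : ℝ) (ω : Ω) : ℝ :=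
  L ((fun p => p + (t, 0)) '' trawlSet a) ω

/-- The sample mean of the `n` observations `X_0, X_δ, …, X_{(n-1)δ}`. -/
def sampleMean {Ω : Type*} (X : ℝ → Ω → ℝ) (δ : ℝ) (n : ℕ) (ω : Ω) : ℝ :=
  (1 / (n : ℝ)) * ∑ k ∈ Finset.range n, X (k * δ) ω

/-- The sample autocovariance at lag `l`:
`(1/n) ∑_{k=0}^{n-1-l} (X_{(l+k)δ} - X̄)(X_{kδ} - X̄)` (an empty sum if `l ≥ n`). -/
def sampleAutocov {Ω : Type*} (X : ℝ → Ω → ℝ) (δ : ℝ) (n l : ℕ) (ω : Ω) : ℝ :=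
  (1 / (n : ℝ)) * ∑ k ∈ Finset.range (n - l),
    (X (((l + k : ℕ) : ℝ) * δ) ω - sampleMean X δ n ω) * (X (k * δ) ω - sampleMean X δ n ω)

/-- The estimator of `a(t)` from the observations `X_0, X_δ, …, X_{(n-1)δ}`: for `t = 0` it is
`(1/(2δn)) ∑_{k=0}^{n-2} (X_{(k+1)δ} - X_{kδ})²`, and for `t > 0` the difference quotient of
sample autocovariances at the lags `l + 1` and `l`, where `lδ ≤ t < (l+1)δ`. -/
def trawlEstimator {Ω : Type*} (X : ℝ → Ω → ℝ) (δ : ℝ) (n : ℕ) (t : ℝ) (ω : Ω) : ℝ :=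
  if t = 0 then
    (1 / (2 * δ * n)) * ∑ k ∈ Finset.range (n - 1),
      (X (((k + 1 : ℕ) : ℝ) * δ) ω - X (k * δ) ω) ^ 2
  else
    -(1 / δ) * (sampleAutocov X δ n (⌊t / δ⌋₊ + 1) ω - sampleAutocov X δ n ⌊t / δ⌋₊ ω)

end

/-! Write `Γ(h) = ∫_h^∞ a`, the area of `A_s ∩ A_{s+h}` and hence the autocovariance of the trawl
process at lag `h`. Since `a` is monotone and continuous, the difference quotients of `-Γ` over
`[lΔ, (l+1)Δ]` tend to `a(t)`. So it suffices that the sample quantity is close to its mean at the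
scale `nΔ`.

Let `Z` be the centered observations. Up to boundary terms with bounded first moment, `n(Γ̂_{l+1} -
Γ̂_l)` equals `∑ Z_k (Z_{k+l+1} - Z_{k+l})`: centering by the sample mean only produces a
telescoping sum (`sample_autocov_sub_eq`). At `t = 0` the sum is `∑ (Z_{k+1} - Z_k)²`. Both are sums
`∑ U_k V_k`, where `U_k` and `V_k` are integrals of simple functions `u_k`, `v_k` against the
centered basis, and `V_k` is an increment.

The variance is controlled by a fourth moment formula: `E[XYZW]` is `κ ∫ fghk` plus the three
pairings of second moments (`IsSimpleIntegral.fourthMomentIdentity`). Two facts about increments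
make this bound linear in `Δ`: `∫ |v_k| ≤ 2Δ a(0)`, and `∑_k |v_k| ≤ 2` pointwise, because each
point of the plane enters the moving trawl set at most once and leaves it at most once. Hence the
variance is `O(nΔ)` (`IsSimpleIntegral.integral_sum_mul_sub_sq_le`) with no assumption on the decay
of `Γ`. Division by `nΔ` leaves an error of order `(nΔ)^{-1/2}` in `L¹`, and Markov's inequality
concludes. -/

/-- A nonnegative additive function on `[0, ∞)` is linear. -/
theorem eq_mul_of_additive_of_nonneg {f : ℝ → ℝ}
    (hadd : ∀ x y, 0 ≤ x → 0 ≤ y → f (x + y) = f x + f y) (hf : ∀ x, 0 ≤ x → 0 ≤ f x)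
    {x : ℝ} (hx : 0 ≤ x) : f x = x * f 1 := by
  have hmono : ∀ x y, 0 ≤ x → x ≤ y → f x ≤ f y := fun x y h0 h => by
    have := hadd x (y - x) h0 (sub_nonneg.2 h)
    rw [add_sub_cancel] at this
    linarith [hf (y - x) (sub_nonneg.2 h)]
  have h0 : f 0 = 0 := by simpa using hadd 0 0 le_rfl le_rfl
  have hnat : ∀ (n : ℕ) (y : ℝ), 0 ≤ y → f (n * y) = n * f y := fun n y hy => by
    induction n with
    | zero => simp [h0]
    | succ n ih =>
      push_cast
      rw [add_mul, one_mul, hadd _ _ (by positivity) hy, ih]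
      ring
  -- By monotonicity `n f(x) = f(nx)` lies between `⌊nx⌋ f(1)` and `(⌊nx⌋ + 1) f(1)`, as does `nx
  -- f(1)`.
  have hbd : ∀ n : ℕ, n * |f x - x * f 1| ≤ f 1 := fun n => by
    have hnx : (0 : ℝ) ≤ n * x := by positivity
    have h1 := hmono _ _ (by positivity) (Nat.floor_le hnx)
    have h2 := hmono _ _ hnx (Nat.lt_floor_add_one (n * x)).le
    have e1 := hnat ⌊n * x⌋₊ 1 zero_le_one
    have e2 := hnat (⌊n * x⌋₊ + 1) 1 zero_le_one
    push_cast at e2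
    rw [mul_one] at e1 e2
    rw [e1, hnat n x hx] at h1
    rw [e2, hnat n x hx] at h2
    have h1' := hf 1 zero_le_one
    have l1 := mul_le_mul_of_nonneg_right (Nat.floor_le hnx) h1'
    have l2 := mul_le_mul_of_nonneg_right (Nat.lt_floor_add_one (n * x)).le h1'
    rw [← abs_of_nonneg (Nat.cast_nonneg (α := ℝ) n), ← abs_mul, abs_le]
    constructor <;> nlinarith
  by_contra hne
  have hpos : 0 < |f x - x * f 1| := abs_pos.2 (sub_ne_zero.2 hne)
  obtain ⟨n, hn⟩ := exists_nat_gt (f 1 / |f x - x * f 1|)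
  rw [div_lt_iff₀ hpos] at hn
  exact absurd (hbd n) (not_le.2 hn)

/-! ### Integrability of a summand of an independent sum -/

section Moments

variable {Ω : Type*} [MeasurableSpace Ω] {P : Measure Ω} [IsProbabilityMeasure P]

/-- By Fubini, `x ↦ x + y` is in `L^p` of the law of `X` for almost every `y`; a single such `y`
suffices, as constants are in `L^p`. -/
theorem ProbabilityTheory.IndepFun.memLp_left_of_memLp_add {X Y : Ω → ℝ} (h : IndepFun X Y P)
    (hX : Measurable X) (hY : Measurable Y) {p : ℝ≥0∞} (hp : p ≠ 0) (hp' : p ≠ ∞)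
    (hXY : MemLp (X + Y) p P) : MemLp X p P := by
  have hmap := (indepFun_iff_map_prod_eq_prod_map_map hX.aemeasurable hY.aemeasurable).1 h
  have : IsProbabilityMeasure (P.map X) := Measure.isProbabilityMeasure_map hX.aemeasurable
  have : IsProbabilityMeasure (P.map Y) := Measure.isProbabilityMeasure_map hY.aemeasurable
  have h1 : MemLp (fun q : ℝ × ℝ => q.1 + q.2) p ((P.map X).prod (P.map Y)) := by
    rw [← hmap]
    exact (memLp_map_measure_iff (by fun_prop) (by fun_prop)).2 hXY
  have h2 := (h1.integrable_norm_rpow hp hp').prod_left_ae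
  obtain ⟨y, hy⟩ := h2.exists
  have h3 : MemLp (fun x : ℝ => x + y) p (P.map X) :=
    (integrable_norm_rpow_iff (by fun_prop) hp hp').1 hy
  have h4 : MemLp (id : ℝ → ℝ) p (P.map X) := by
    convert h3.sub (memLp_const y) using 1
    ext x
    simp
  exact (memLp_map_measure_iff (by fun_prop) hX.aemeasurable).1 h4

end Moments

/-- A centered real field `c`, indexed by the measurable sets of finite `μ`-measure, which is
finitely additive, pairwise independent over disjoint sets, and whose second and fourth moments
are those of a square-integrable Lévy basis of unit variance with fourth cumulant `κ`. -/
structure IsCenteredField {E Ω : Type*} [MeasurableSpace E] [MeasurableSpace Ω]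
    (c : Set E → Ω → ℝ) (μ : Measure E) (P : Measure Ω) (κ : ℝ) : Prop where
  memLp : ∀ A, MeasurableSet A → μ A < ∞ → MemLp (c A) 4 P
  add : ∀ A B, MeasurableSet A → MeasurableSet B → μ A < ∞ → μ B < ∞ → Disjoint A B →
    c (A ∪ B) =ᵐ[P] c A + c B
  indep : ∀ A B, MeasurableSet A → MeasurableSet B → μ A < ∞ → μ B < ∞ → Disjoint A B →
    IndepFun (c A) (c B) P
  mean : ∀ A, MeasurableSet A → μ A < ∞ → ∫ ω, c A ω ∂P = 0
  second : ∀ A, MeasurableSet A → μ A < ∞ → ∫ ω, c A ω ^ 2 ∂P = μ.real A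
  fourth : ∀ A, MeasurableSet A → μ A < ∞ →
    ∫ ω, c A ω ^ 4 ∂P = κ * μ.real A + 3 * μ.real A ^ 2
  nonneg : 0 ≤ κ

/-! ### Finite additivity of a Lévy basis -/

section LevyBasis

variable {E Ω : Type*} [MeasurableSpace E] [MeasurableSpace Ω] {P : Measure Ω}
  {L : Set E → Ω → ℝ} {μ : Measure E}

/-- The constant sequence `∅, ∅, …` has convergent partial sums, so their increments, all equal to
`L ∅`, tend to `0`. -/
theorem IsLevyBasis.empty_ae (hL : IsLevyBasis L μ P) : L ∅ =ᵐ[P] 0 := by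
  have h := hL.sigmaAdditive (fun _ => ∅) (fun _ => MeasurableSet.empty)
    (fun _ _ _ => disjoint_bot_left) (by simp)
  filter_upwards [h] with ω hω
  simp only [iUnion_empty] at hω
  have h1 := ((tendsto_add_atTop_iff_nat 1).2 hω).sub hω
  simp only [Finset.sum_range_succ, add_sub_cancel_left, sub_self] at h1
  exact tendsto_nhds_unique tendsto_const_nhds h1

theorem IsLevyBasis.union_ae (hL : IsLevyBasis L μ P) {A B : Set E} (hA : MeasurableSet A)
    (hB : MeasurableSet B) (hA' : μ A < ∞) (hB' : μ B < ∞) (hAB : Disjoint A B) :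
    L (A ∪ B) =ᵐ[P] L A + L B := by
  let S : ℕ → Set E := fun n => if n = 0 then A else if n = 1 then B else ∅
  have hU : ⋃ i, S i = A ∪ B := by
    ext p
    simp only [mem_iUnion, mem_union, S]
    constructor
    · rintro ⟨i, hi⟩
      split_ifs at hi <;> simp_all
    · rintro (h | h)
      · exact ⟨0, by simpa⟩
      · exact ⟨1, by simpa⟩
  have h := hL.sigmaAdditive S (fun i => by simp only [S]; split_ifs <;> simp [hA, hB])
    (fun i j hij => by
      simp only [Function.onFun, S]
      split_ifs <;> simp_all [hAB.symm]) (by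
      rw [hU]
      exact measure_union_lt_top hA' hB')
  filter_upwards [h, hL.empty_ae] with ω hω h0
  rw [hU] at hω
  refine tendsto_nhds_unique hω (tendsto_atTop_of_eventually_const (i₀ := 2) fun i hi => ?_)
  obtain ⟨k, rfl⟩ := Nat.exists_eq_add_of_le hi
  rw [Finset.sum_range_add]
  simp only [S, Finset.sum_range_succ, Finset.sum_range_zero]
  rw [Finset.sum_eq_zero (fun i _ => by simpa [show 2 + i ≠ 1 by omega] using h0)]
  simp

end LevyBasis

/-! ### Second and fourth moments of independent sums -/

section MomentsOfLaw

variable {Ω : Type*} [MeasurableSpace Ω] {P : Measure Ω} [IsProbabilityMeasure P]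

theorem ProbabilityTheory.IndepFun.integral_add_pow_two {X Y : Ω → ℝ} (h : IndepFun X Y P)
    (hX : MemLp X 4 P) (hY : MemLp Y 4 P) (hX0 : ∫ ω, X ω ∂P = 0) :
    ∫ ω, (X ω + Y ω) ^ 2 ∂P = ∫ ω, X ω ^ 2 ∂P + ∫ ω, Y ω ^ 2 ∂P := by
  have hX2 : MemLp X 2 P := hX.mono_exponent (by norm_num)
  have hY2 : MemLp Y 2 P := hY.mono_exponent (by norm_num)
  have hXY : Integrable (fun ω => X ω * Y ω) P := hX2.integrable_mul hY2
  have e : ∀ ω, (X ω + Y ω) ^ 2 = X ω ^ 2 + Y ω ^ 2 + 2 * (X ω * Y ω) := fun ω => by ring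
  simp_rw [e]
  rw [integral_add (hX2.integrable_sq.fun_add hY2.integrable_sq) (hXY.const_mul 2),
    integral_add hX2.integrable_sq hY2.integrable_sq, integral_const_mul,
    h.integral_fun_mul_eq_mul_integral hX.1 hY.1, hX0]
  ring

theorem MeasureTheory.MemLp.integrable_pow_of_four {X : Ω → ℝ} (hX : MemLp X 4 P) {k : ℕ}
    (hk : k ≤ 4) : Integrable (fun ω => X ω ^ k) P := by
  rcases Nat.eq_zero_or_pos k with rfl | hk0
  · simp
  have h := (hX.mono_exponent (p := (k : ℝ≥0∞)) (by exact_mod_cast hk)).integrable_norm_pow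
    hk0.ne'
  refine h.mono' (hX.1.pow k) (Eventually.of_forall fun ω => ?_)
  simp

theorem ProbabilityTheory.IndepFun.integrable_pow_mul_pow {X Y : Ω → ℝ} (h : IndepFun X Y P)
    (hX : MemLp X 4 P) (hY : MemLp Y 4 P) {i j : ℕ} (hi : i ≤ 4) (hj : j ≤ 4) :
    Integrable (fun ω => X ω ^ i * Y ω ^ j) P :=
  (h.comp (measurable_id.pow_const i) (measurable_id.pow_const j)).integrable_mul
    (hX.integrable_pow_of_four hi) (hY.integrable_pow_of_four hj)

omit [IsProbabilityMeasure P] in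
theorem ProbabilityTheory.IndepFun.integral_pow_mul_pow {X Y : Ω → ℝ} (h : IndepFun X Y P)
    (hX : MemLp X 4 P) (hY : MemLp Y 4 P) (i j : ℕ) :
    ∫ ω, X ω ^ i * Y ω ^ j ∂P = (∫ ω, X ω ^ i ∂P) * ∫ ω, Y ω ^ j ∂P :=
  (h.comp (measurable_id.pow_const i) (measurable_id.pow_const j)).integral_fun_mul_eq_mul_integral
    (hX.1.pow i) (hY.1.pow j)

theorem ProbabilityTheory.IndepFun.integral_add_pow_four {X Y : Ω → ℝ} (h : IndepFun X Y P)
    (hX : MemLp X 4 P) (hY : MemLp Y 4 P) (hX0 : ∫ ω, X ω ∂P = 0) (hY0 : ∫ ω, Y ω ∂P = 0) :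
    ∫ ω, (X ω + Y ω) ^ 4 ∂P = ∫ ω, X ω ^ 4 ∂P + ∫ ω, Y ω ^ 4 ∂P +
      6 * ((∫ ω, X ω ^ 2 ∂P) * ∫ ω, Y ω ^ 2 ∂P) := by
  have hi : ∀ i j : ℕ, i ≤ 4 → j ≤ 4 → Integrable (fun ω => X ω ^ i * Y ω ^ j) P :=
    fun i j => h.integrable_pow_mul_pow hX hY
  have hm := h.integral_pow_mul_pow hX hY
  have e : ∀ ω, (X ω + Y ω) ^ 4 = X ω ^ 4 + Y ω ^ 4 + 6 * (X ω ^ 2 * Y ω ^ 2) +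
      (4 * (X ω ^ 3 * Y ω ^ 1) + 4 * (X ω ^ 1 * Y ω ^ 3)) := fun ω => by ring
  have i4 := hX.integrable_pow_of_four (le_refl 4)
  have j4 := hY.integrable_pow_of_four (le_refl 4)
  have i22 := (hi 2 2 (by norm_num) (by norm_num)).const_mul 6
  have i31 := (hi 3 1 (by norm_num) (by norm_num)).const_mul 4
  have i13 := (hi 1 3 (by norm_num) (by norm_num)).const_mul 4
  simp_rw [e]
  rw [integral_add ((i4.fun_add j4).fun_add i22) (i31.fun_add i13), integral_add (i4.fun_add j4) i22,
    integral_add i4 j4, integral_add i31 i13]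
  rw [integral_const_mul, integral_const_mul, integral_const_mul, hm, hm, hm]
  simp only [pow_one, hX0, hY0]
  ring

end MomentsOfLaw

/-- The field `L` with its means subtracted. -/
noncomputable def centeredField {E Ω : Type*} [MeasurableSpace Ω] (L : Set E → Ω → ℝ) (P : Measure Ω)
    (A : Set E) (ω : Ω) : ℝ :=
  L A ω - ∫ ω', L A ω' ∂P

/-! ### Moments of a homogeneous Lévy basis -/

section HomogeneousLevyBasis

variable {Ω Ω' : Type*} [MeasurableSpace Ω] [MeasurableSpace Ω'] {P : Measure Ω}
  [IsProbabilityMeasure P] {P' : Measure Ω'} [IsProbabilityMeasure P']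
  {L : Set (ℝ × ℝ) → Ω → ℝ} {L' : Ω' → ℝ} {γ b : ℝ} {ν : Measure ℝ}

theorem volume_Ioc_prod_Ioc (x y : ℝ) :
    volume (Ioc x y ×ˢ Ioc (0 : ℝ) 1) = ENNReal.ofReal (y - x) := by
  rw [Measure.volume_eq_prod, Measure.prod_prod]
  simp

theorem IsHomogeneousLevyBasis.map_eq (hL : IsHomogeneousLevyBasis L P γ b ν)
    {A B : Set (ℝ × ℝ)} (hA : MeasurableSet A) (hB : MeasurableSet B)
    (hA' : volume A < ∞) (hAB : volume A = volume B) : P.map (L A) = P.map (L B) := by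
  have hB' : volume B < ∞ := hAB ▸ hA'
  have := Measure.isProbabilityMeasure_map (hL.isLevyBasis.measurable A hA hA').aemeasurable (μ := P)
  have := Measure.isProbabilityMeasure_map (hL.isLevyBasis.measurable B hB hB').aemeasurable (μ := P)
  refine Measure.ext_of_charFun (funext fun z => ?_)
  rw [hL.charFun_eq A hA hA', hL.charFun_eq B hB hB', hAB]

theorem IsHomogeneousLevyBasis.map_eq_seed (hL : IsHomogeneousLevyBasis L P γ b ν)
    (hL' : IsLevySeed L' P' γ b ν) {A : Set (ℝ × ℝ)} (hA : MeasurableSet A)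
    (hA' : volume A = 1) : P.map (L A) = P'.map L' := by
  have hfin : volume A < ∞ := by simp [hA']
  have := Measure.isProbabilityMeasure_map (hL.isLevyBasis.measurable A hA hfin).aemeasurable (μ := P)
  have := Measure.isProbabilityMeasure_map hL'.measurable.aemeasurable (μ := P')
  refine Measure.ext_of_charFun (funext fun z => ?_)
  rw [hL.charFun_eq A hA hfin, hL'.charFun_eq, hA']
  simp

/-- The strip is cut into `n` unit squares, on each of which `L` has the law of the seed. -/
theorem IsHomogeneousLevyBasis.memLp_Ioc_prod (hL : IsHomogeneousLevyBasis L P γ b ν)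
    (hL' : IsLevySeed L' P' γ b ν) (hmom : MemLp L' 4 P') (n : ℕ) :
    MemLp (L (Ioc (0 : ℝ) n ×ˢ Ioc (0 : ℝ) 1)) 4 P := by
  induction n with
  | zero =>
    simp only [Nat.cast_zero, Ioc_self, empty_prod]
    exact (memLp_congr_ae hL.isLevyBasis.empty_ae).2 MemLp.zero
  | succ n ih =>
    have hU : Ioc (0 : ℝ) (n + 1 : ℕ) ×ˢ Ioc (0 : ℝ) 1 =
        Ioc (0 : ℝ) n ×ˢ Ioc (0 : ℝ) 1 ∪ Ioc (n : ℝ) (n + 1) ×ˢ Ioc (0 : ℝ) 1 := by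
      rw [← union_prod, Ioc_union_Ioc_eq_Ioc (by positivity) (by linarith)]
      push_cast
      rfl
    have h1 : MemLp (L (Ioc (n : ℝ) (n + 1) ×ˢ Ioc (0 : ℝ) 1)) 4 P := by
      have hm := hL.map_eq_seed hL' (measurableSet_Ioc.prod measurableSet_Ioc)
        (show volume (Ioc (n : ℝ) (n + 1) ×ˢ Ioc (0 : ℝ) 1) = 1 by
          rw [volume_Ioc_prod_Ioc]; simp)
      have hid : MemLp (id : ℝ → ℝ) 4 (P'.map L') :=
        (memLp_map_measure_iff (by fun_prop) hL'.measurable.aemeasurable).2 hmom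
      rw [← hm] at hid
      exact (memLp_map_measure_iff (by fun_prop) (hL.isLevyBasis.measurable _
        (measurableSet_Ioc.prod measurableSet_Ioc)
        (by rw [volume_Ioc_prod_Ioc]; simp)).aemeasurable).1 hid
    rw [hU]
    refine (memLp_congr_ae (hL.isLevyBasis.union_ae (measurableSet_Ioc.prod measurableSet_Ioc)
      (measurableSet_Ioc.prod measurableSet_Ioc) (by rw [volume_Ioc_prod_Ioc]; simp)
      (by rw [volume_Ioc_prod_Ioc]; simp) ?_)).2 (ih.add h1)
    exact Disjoint.set_prod_left (Ioc_disjoint_Ioc_of_le le_rfl) _ _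

/-- The law of `L A` depends only on the area, so `A` may be replaced by a rectangle inside an
integer strip; `L` of that rectangle is one of two independent summands of a variable in `L⁴`. -/
theorem IsHomogeneousLevyBasis.memLp (hL : IsHomogeneousLevyBasis L P γ b ν)
    (hL' : IsLevySeed L' P' γ b ν) (hmom : MemLp L' 4 P') {A : Set (ℝ × ℝ)}
    (hA : MeasurableSet A) (hA' : volume A < ∞) : MemLp (L A) 4 P := by
  obtain ⟨n, hn⟩ := exists_nat_gt (volume A).toReal
  set x := (volume A).toReal with hx
  have hx0 : 0 ≤ x := ENNReal.toReal_nonneg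
  have hR : ∀ x y : ℝ, MeasurableSet (Ioc x y ×ˢ Ioc (0 : ℝ) 1) := fun x y =>
    measurableSet_Ioc.prod measurableSet_Ioc
  have hR' : ∀ x y : ℝ, volume (Ioc x y ×ˢ Ioc (0 : ℝ) 1) < ∞ := fun x y => by
    rw [volume_Ioc_prod_Ioc]; simp
  have hd : Disjoint (Ioc 0 x ×ˢ Ioc (0 : ℝ) 1) (Ioc x n ×ˢ Ioc (0 : ℝ) 1) :=
    Disjoint.set_prod_left (Ioc_disjoint_Ioc_of_le le_rfl) _ _
  have h1 := hL.memLp_Ioc_prod hL' hmom n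
  rw [← Ioc_union_Ioc_eq_Ioc hx0 hn.le, union_prod, memLp_congr_ae
    (hL.isLevyBasis.union_ae (hR _ _) (hR _ _) (hR' _ _) (hR' _ _) hd)] at h1
  have h2 := (hL.isLevyBasis.indep _ _ (hR _ _) (hR _ _) (hR' _ _) (hR' _ _)
    hd).memLp_left_of_memLp_add (hL.isLevyBasis.measurable _ (hR _ _) (hR' _ _))
    (hL.isLevyBasis.measurable _ (hR _ _) (hR' _ _)) (by norm_num) (by norm_num) h1
  have hm := hL.map_eq hA (hR 0 x) hA' (by
    rw [volume_Ioc_prod_Ioc, sub_zero, hx, ENNReal.ofReal_toReal hA'.ne])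
  have hid : MemLp (id : ℝ → ℝ) 4 (P.map (L (Ioc 0 x ×ˢ Ioc (0 : ℝ) 1))) :=
    (memLp_map_measure_iff (by fun_prop)
      (hL.isLevyBasis.measurable _ (hR _ _) (hR' _ _)).aemeasurable).2 h2
  rw [← hm] at hid
  exact (memLp_map_measure_iff (by fun_prop)
    (hL.isLevyBasis.measurable _ hA hA').aemeasurable).1 hid

/-- The centered moments of `L A` depend only on the volume of `A`. -/
theorem IsHomogeneousLevyBasis.integral_centeredField_pow_eq
    (hL : IsHomogeneousLevyBasis L P γ b ν) {A B : Set (ℝ × ℝ)} (hA : MeasurableSet A)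
    (hB : MeasurableSet B) (hA' : volume A < ∞) (hAB : volume A = volume B) (k : ℕ) :
    ∫ ω, centeredField L P A ω ^ k ∂P = ∫ ω, centeredField L P B ω ^ k ∂P := by
  have key : ∀ C, MeasurableSet C → volume C < ∞ → ∫ ω, centeredField L P C ω ^ k ∂P =
      ∫ x, (x - ∫ y, y ∂P.map (L C)) ^ k ∂P.map (L C) := fun C hC hC' => by
    have hm := (hL.isLevyBasis.measurable C hC hC').aemeasurable (μ := P)
    rw [integral_map hm (by fun_prop), integral_map hm (by fun_prop)]
    rfl
  rw [key A hA hA', key B hB (hAB ▸ hA'), hL.map_eq hA hB hA' hAB]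

/-- As functions of the area `x`, the centered second moment `m₂` and the fourth cumulant `m₄ - 3x²`
are additive and nonnegative, hence linear. The slope of `m₂` is the variance of the seed, and `κ`
is the slope of the fourth cumulant. -/
theorem IsHomogeneousLevyBasis.exists_isCenteredField (hL : IsHomogeneousLevyBasis L P γ b ν)
    (hL' : IsLevySeed L' P' γ b ν) (hvar : Var[L'; P'] = 1) (hmom : MemLp L' 4 P') :
    ∃ κ : ℝ, IsCenteredField (centeredField L P) volume P κ := by
  have hLp : ∀ A, MeasurableSet A → volume A < ∞ → MemLp (L A) 4 P := fun A =>
    hL.memLp hL' hmom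
  have hint : ∀ A, MeasurableSet A → volume A < ∞ → Integrable (L A) P := fun A hA hA' =>
    (hLp A hA hA').integrable (by norm_num)
  have hcLp : ∀ A, MeasurableSet A → volume A < ∞ → MemLp (centeredField L P A) 4 P :=
    fun A hA hA' => (hLp A hA hA').sub (memLp_const _)
  have hadd : ∀ A B, MeasurableSet A → MeasurableSet B → volume A < ∞ → volume B < ∞ →
      Disjoint A B → centeredField L P (A ∪ B) =ᵐ[P] centeredField L P A + centeredField L P B := by
    intro A B hA hB hA' hB' hAB
    have h := hL.isLevyBasis.union_ae hA hB hA' hB' hAB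
    have hi : ∫ ω, L (A ∪ B) ω ∂P = ∫ ω, L A ω ∂P + ∫ ω, L B ω ∂P := by
      rw [integral_congr_ae h, ← integral_add (hint A hA hA') (hint B hB hB')]
      rfl
    filter_upwards [h] with ω hω
    simp only [centeredField, Pi.add_apply, hω, hi]
    ring
  have hind : ∀ A B, MeasurableSet A → MeasurableSet B → volume A < ∞ → volume B < ∞ →
      Disjoint A B → IndepFun (centeredField L P A) (centeredField L P B) P :=
    fun A B hA hB hA' hB' hAB => (hL.isLevyBasis.indep A B hA hB hA' hB' hAB).comp
      (φ := fun x => x - ∫ ω', L A ω' ∂P) (ψ := fun x => x - ∫ ω', L B ω' ∂P)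
      (by fun_prop) (by fun_prop)
  have hmean : ∀ A, MeasurableSet A → volume A < ∞ → ∫ ω, centeredField L P A ω ∂P = 0 :=
    fun A hA hA' => by
      simp only [centeredField]
      rw [integral_sub (hint A hA hA') (integrable_const _)]
      simp
  have hR : ∀ x y : ℝ, MeasurableSet (Ioc x y ×ˢ Ioc (0 : ℝ) 1) := fun x y =>
    measurableSet_Ioc.prod measurableSet_Ioc
  have hR' : ∀ x y : ℝ, volume (Ioc x y ×ˢ Ioc (0 : ℝ) 1) < ∞ := fun x y => by
    rw [volume_Ioc_prod_Ioc]; simp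
  let m : ℕ → ℝ → ℝ := fun k x => ∫ ω, centeredField L P (Ioc 0 x ×ˢ Ioc (0 : ℝ) 1) ω ^ k ∂P
  have hm : ∀ A, MeasurableSet A → volume A < ∞ → ∀ k,
      ∫ ω, centeredField L P A ω ^ k ∂P = m k (volume.real A) := fun A hA hA' k =>
    hL.integral_centeredField_pow_eq hA (hR _ _) hA' (by
      rw [volume_Ioc_prod_Ioc, sub_zero, Measure.real, ENNReal.ofReal_toReal hA'.ne]) k
  -- Adjacent rectangles of areas `x` and `y` realize the moments at `x`, `y` and `x + y` by an
  -- independent pair and its sum.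
  have hsplit : ∀ x y, 0 ≤ x → 0 ≤ y → ∃ X Y : Ω → ℝ, IndepFun X Y P ∧ MemLp X 4 P ∧
      MemLp Y 4 P ∧ ∫ ω, X ω ∂P = 0 ∧ ∫ ω, Y ω ∂P = 0 ∧
      ∀ k, m k x = ∫ ω, X ω ^ k ∂P ∧ m k y = ∫ ω, Y ω ^ k ∂P ∧
        m k (x + y) = ∫ ω, (X ω + Y ω) ^ k ∂P := by
    intro x y hx hy
    have hd : Disjoint (Ioc 0 x ×ˢ Ioc (0 : ℝ) 1) (Ioc x (x + y) ×ˢ Ioc (0 : ℝ) 1) :=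
      Disjoint.set_prod_left (Ioc_disjoint_Ioc_of_le le_rfl) _ _
    refine ⟨centeredField L P (Ioc 0 x ×ˢ Ioc (0 : ℝ) 1),
      centeredField L P (Ioc x (x + y) ×ˢ Ioc (0 : ℝ) 1), hind _ _ (hR _ _) (hR _ _) (hR' _ _)
      (hR' _ _) hd, hcLp _ (hR _ _) (hR' _ _), hcLp _ (hR _ _) (hR' _ _),
      hmean _ (hR _ _) (hR' _ _), hmean _ (hR _ _) (hR' _ _), fun k => ⟨rfl, ?_, ?_⟩⟩
    · exact hL.integral_centeredField_pow_eq (hR _ _) (hR _ _) (hR' _ _)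
        (by simp only [volume_Ioc_prod_Ioc]; congr 1; ring) k
    · have h := hadd _ _ (hR 0 x) (hR x (x + y)) (hR' _ _) (hR' _ _) hd
      rw [← union_prod, Ioc_union_Ioc_eq_Ioc hx (by linarith)] at h
      refine integral_congr_ae ?_
      filter_upwards [h] with ω hω
      rw [hω]
      rfl
  have hm2 : ∀ x, 0 ≤ x → m 2 x = x := fun x hx => by
    have h1 : m 2 1 = 1 := by
      have hv1 : volume (Ioc (0 : ℝ) 1 ×ˢ Ioc (0 : ℝ) 1) = 1 := by
        rw [volume_Ioc_prod_Ioc]; simp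
      have hme := (hL.isLevyBasis.measurable _ (hR 0 1) (hR' 0 1)).aemeasurable (μ := P)
      have hv : Var[L (Ioc (0 : ℝ) 1 ×ˢ Ioc (0 : ℝ) 1); P] = Var[L'; P'] := by
        rw [← variance_id_map hL'.measurable.aemeasurable,
          ← hL.map_eq_seed hL' (hR 0 1) hv1, variance_id_map hme]
      rw [hvar, variance_eq_integral hme] at hv
      exact hv
    have := eq_mul_of_additive_of_nonneg (f := m 2) (fun x y hx hy => by
      obtain ⟨X, Y, hXY, hX, hY, hX0, -, h⟩ := hsplit x y hx hy
      rw [(h 2).1, (h 2).2.1, (h 2).2.2, hXY.integral_add_pow_two hX hY hX0])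
      (fun x _ => integral_nonneg fun ω => sq_nonneg _) hx
    rw [this, h1, mul_one]
  have hadd4 : ∀ x y, 0 ≤ x → 0 ≤ y →
      m 4 (x + y) - 3 * (x + y) ^ 2 = (m 4 x - 3 * x ^ 2) + (m 4 y - 3 * y ^ 2) := by
    intro x y hx hy
    obtain ⟨X, Y, hXY, hX, hY, hX0, hY0, h⟩ := hsplit x y hx hy
    rw [(h 4).1, (h 4).2.1, (h 4).2.2, hXY.integral_add_pow_four hX hY hX0 hY0, ← (h 2).1,
      ← (h 2).2.1, hm2 x hx, hm2 y hy]
    ring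
  -- Divisibility makes the fourth cumulant nonnegative: it equals `n (m₄(x/n) - 3(x/n)²) ≥ -3x²/n`
  -- for every `n ≥ 1`.
  have hnn4 : ∀ x, 0 ≤ x → 0 ≤ m 4 x - 3 * x ^ 2 := fun x hx => by
    have hdiv : ∀ n : ℕ, ∀ y, 0 ≤ y →
        m 4 (n * y) - 3 * (n * y) ^ 2 = n * (m 4 y - 3 * y ^ 2) := fun n y hy => by
      induction n with
      | zero =>
        have := hadd4 0 0 le_rfl le_rfl
        simp only [add_zero] at this
        simp only [Nat.cast_zero, zero_mul]
        linarith
      | succ n ih =>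
        push_cast
        rw [add_mul, one_mul, hadd4 _ _ (by positivity) hy, ih]
        ring
    by_contra! hneg
    obtain ⟨n, hn⟩ := exists_nat_gt (3 * x ^ 2 / -(m 4 x - 3 * x ^ 2))
    have hn0 : (0 : ℝ) < n := lt_of_le_of_lt (div_nonneg (by positivity) (by linarith)) hn
    rw [div_lt_iff₀ (by linarith)] at hn
    have h1 := hdiv n (x / n) (by positivity)
    rw [mul_div_cancel₀ _ hn0.ne'] at h1
    have h2 : 0 ≤ m 4 (x / n) := integral_nonneg fun ω => by positivity
    have h3 : (n : ℝ) * (n * (m 4 (x / n) - 3 * (x / n) ^ 2)) =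
      n * (n * m 4 (x / n)) - 3 * x ^ 2 := by
        field_simp
    rw [← h1] at h3
    have h4 : 0 ≤ n * (n * m 4 (x / n)) := by positivity
    linarith
  have hm4 := fun x hx => eq_mul_of_additive_of_nonneg hadd4 hnn4 (x := x) hx
  refine ⟨m 4 1 - 3 * 1 ^ 2, hcLp, hadd, hind, hmean, fun A hA hA' => ?_, fun A hA hA' => ?_,
    hnn4 1 zero_le_one⟩
  · rw [hm A hA hA', hm2 _ measureReal_nonneg]
  · rw [hm A hA hA']
    linarith [hm4 (volume.real A) measureReal_nonneg]

end HomogeneousLevyBasis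

/-! ### The fourth moment formula for simple integrals -/

section FourthMoments

variable {α : Type*} [MeasurableSpace α] {μ : Measure α}

theorem MeasureTheory.MemLp.mul_of_four {X Y : α → ℝ} (hX : MemLp X 4 μ) (hY : MemLp Y 4 μ) :
    MemLp (fun ω => X ω * Y ω) 2 μ := by
  have : ENNReal.HolderTriple 4 4 2 := ⟨by
    rw [show (4 : ℝ≥0∞) = 2 * 2 by norm_num, ENNReal.mul_inv (by norm_num) (by norm_num),
      ← mul_add, ENNReal.inv_two_add_inv_two, mul_one]⟩
  exact hY.mul' hX

theorem MeasureTheory.MemLp.integrable_mul_of_four {X Y Z W : α → ℝ} (hX : MemLp X 4 μ)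
    (hY : MemLp Y 4 μ) (hZ : MemLp Z 4 μ) (hW : MemLp W 4 μ) :
    Integrable (fun ω => X ω * Y ω * (Z ω * W ω)) μ :=
  (hX.mul_of_four hY).integrable_mul (hZ.mul_of_four hW)

variable {E Ω : Type*} [MeasurableSpace E] [MeasurableSpace Ω] {P : Measure Ω}
  {μ : Measure E} {c : Set E → Ω → ℝ} {κ : ℝ} {A B C D : Set E}

namespace IsCenteredField

theorem empty_ae (hc : IsCenteredField c μ P κ) : c ∅ =ᵐ[P] 0 := by
  filter_upwards [hc.add ∅ ∅ .empty .empty (by simp) (by simp) (disjoint_empty _)] with ω hω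
  simpa using hω

theorem integral_mul_of_disjoint (hc : IsCenteredField c μ P κ) (hA : MeasurableSet A)
    (hB : MeasurableSet B) (hA' : μ A < ∞) (hB' : μ B < ∞) (hAB : Disjoint A B) :
    ∫ ω, c A ω * c B ω ∂P = 0 := by
  rw [(hc.indep A B hA hB hA' hB' hAB).integral_fun_mul_eq_mul_integral (hc.memLp A hA hA').1
    (hc.memLp B hB hB').1, hc.mean A hA hA', zero_mul]

theorem integral_pow_mul_pow (hc : IsCenteredField c μ P κ) (hA : MeasurableSet A)
    (hB : MeasurableSet B) (hA' : μ A < ∞) (hB' : μ B < ∞) (hAB : Disjoint A B) (i j : ℕ) :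
    ∫ ω, c A ω ^ i * c B ω ^ j ∂P = (∫ ω, c A ω ^ i ∂P) * ∫ ω, c B ω ^ j ∂P :=
  (hc.indep A B hA hB hA' hB' hAB).integral_pow_mul_pow (hc.memLp A hA hA') (hc.memLp B hB hB') i j

/-- Independence is given only for pairs of sets, so the mixed moment is found by polarization:
expand `E[c(A)² c(B ∪ C)²]`, which factorizes by independence of the pair `A`, `B ∪ C`, and note
that the squares already account for the whole value. -/
theorem integral_sq_mul_mul (hc : IsCenteredField c μ P κ) (hA : MeasurableSet A)
    (hB : MeasurableSet B) (hC : MeasurableSet C) (hA' : μ A < ∞) (hB' : μ B < ∞)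
    (hC' : μ C < ∞) (hAB : Disjoint A B) (hAC : Disjoint A C) (hBC : Disjoint B C) :
    ∫ ω, c A ω ^ 2 * (c B ω * c C ω) ∂P = 0 := by
  have hBC' : μ (B ∪ C) < ∞ := measure_union_lt_top hB' hC'
  have h := hc.integral_pow_mul_pow hA (hB.union hC) hA' hBC' (hAB.union_right hAC) 2 2
  have hAm := hc.memLp A hA hA'
  have hBm := hc.memLp B hB hB'
  have hCm := hc.memLp C hC hC'
  have e : ∫ ω, c A ω ^ 2 * c (B ∪ C) ω ^ 2 ∂P = ∫ ω, (c A ω ^ 2 * c B ω ^ 2 +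
      c A ω ^ 2 * c C ω ^ 2 + 2 * (c A ω ^ 2 * (c B ω * c C ω))) ∂P := by
    refine integral_congr_ae ?_
    filter_upwards [hc.add B C hB hC hB' hC' hBC] with ω hω
    rw [hω, Pi.add_apply]
    ring
  have iAB := hAm.integrable_mul_of_four hAm hBm hBm
  have iAC := hAm.integrable_mul_of_four hAm hCm hCm
  have iABC := hAm.integrable_mul_of_four hAm hBm hCm
  simp only [← pow_two] at iAB iAC iABC
  rw [e, integral_add (iAB.fun_add iAC) (iABC.const_mul 2), integral_add iAB iAC,
    integral_const_mul, hc.integral_pow_mul_pow hA hB hA' hB' hAB,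
    hc.integral_pow_mul_pow hA hC hA' hC' hAC, hc.second _ (hB.union hC) hBC', hc.second _ hA hA',
    hc.second _ hB hB', hc.second _ hC hC', measureReal_union hBC hC hB'.ne hC'.ne] at h
  linarith

/-- Polarization again, now of `E[c(A ∪ B)² c(C) c(D)] = 0`. -/
theorem integral_mul_mul_mul (hc : IsCenteredField c μ P κ) (hA : MeasurableSet A)
    (hB : MeasurableSet B) (hC : MeasurableSet C) (hD : MeasurableSet D) (hA' : μ A < ∞)
    (hB' : μ B < ∞) (hC' : μ C < ∞) (hD' : μ D < ∞) (hAB : Disjoint A B) (hAC : Disjoint A C)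
    (hAD : Disjoint A D) (hBC : Disjoint B C) (hBD : Disjoint B D) (hCD : Disjoint C D) :
    ∫ ω, c A ω * c B ω * (c C ω * c D ω) ∂P = 0 := by
  have hAB' : μ (A ∪ B) < ∞ := measure_union_lt_top hA' hB'
  have h := hc.integral_sq_mul_mul (hA.union hB) hC hD hAB' hC' hD' (hAC.union_left hBC)
    (hAD.union_left hBD) hCD
  have hAm := hc.memLp A hA hA'
  have hBm := hc.memLp B hB hB'
  have hCm := hc.memLp C hC hC'
  have hDm := hc.memLp D hD hD'
  have e : ∫ ω, c (A ∪ B) ω ^ 2 * (c C ω * c D ω) ∂P = ∫ ω, (c A ω ^ 2 * (c C ω * c D ω) +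
      c B ω ^ 2 * (c C ω * c D ω) + 2 * (c A ω * c B ω * (c C ω * c D ω))) ∂P := by
    refine integral_congr_ae ?_
    filter_upwards [hc.add A B hA hB hA' hB' hAB] with ω hω
    rw [hω, Pi.add_apply]
    ring
  have iA := hAm.integrable_mul_of_four hAm hCm hDm
  have iB := hBm.integrable_mul_of_four hBm hCm hDm
  have iAB := hAm.integrable_mul_of_four hBm hCm hDm
  simp only [← pow_two] at iA iB
  rw [e, integral_add (iA.fun_add iB) (iAB.const_mul 2), integral_add iA iB, integral_const_mul,
    hc.integral_sq_mul_mul hA hC hD hA' hC' hD' hAC hAD hCD,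
    hc.integral_sq_mul_mul hB hC hD hB' hC' hD' hBC hBD hCD] at h
  linarith

end IsCenteredField

/-- The random variable `X` is the integral of the simple function `f`, built from sets in `S`,
with respect to the field `c`. -/
inductive IsSimpleIntegral (c : Set E → Ω → ℝ) (P : Measure Ω) (S : Set (Set E)) :
    (Ω → ℝ) → (E → ℝ) → Prop
  | of {A : Set E} (hA : A ∈ S) : IsSimpleIntegral c P S (c A) (A.indicator 1)
  | zero : IsSimpleIntegral c P S 0 0
  | add {X Y : Ω → ℝ} {f g : E → ℝ} (hX : IsSimpleIntegral c P S X f)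
      (hY : IsSimpleIntegral c P S Y g) : IsSimpleIntegral c P S (X + Y) (f + g)
  | neg {X : Ω → ℝ} {f : E → ℝ} (hX : IsSimpleIntegral c P S X f) :
      IsSimpleIntegral c P S (-X) (-f)
  | congr {X Y : Ω → ℝ} {f : E → ℝ} (hX : IsSimpleIntegral c P S X f) (h : X =ᵐ[P] Y) :
      IsSimpleIntegral c P S Y f

/-- The fourth moment identity of integrals `X, Y, Z, W` of functions `f, g, h, k` with respect
to a centered field with fourth cumulant `κ`. -/
def FourthMomentIdentity (κ : ℝ) (P : Measure Ω) (μ : Measure E) (X Y Z W : Ω → ℝ)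
    (f g h k : E → ℝ) : Prop :=
  ∫ ω, X ω * Y ω * (Z ω * W ω) ∂P = κ * ∫ p, f p * g p * (h p * k p) ∂μ +
    ((∫ p, f p * g p ∂μ) * ∫ p, h p * k p ∂μ) + ((∫ p, f p * h p ∂μ) * ∫ p, g p * k p ∂μ) +
    (∫ p, f p * k p ∂μ) * ∫ p, g p * h p ∂μ

/-- Cyclic invariance allows linearity to be checked in the first slot only. -/
theorem FourthMomentIdentity.rotate {X Y Z W : Ω → ℝ} {f g h k : E → ℝ}
    (H : FourthMomentIdentity κ P μ X Y Z W f g h k) :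
    FourthMomentIdentity κ P μ Y Z W X g h k f := by
  unfold FourthMomentIdentity at H ⊢
  have e1 : ∀ ω, Y ω * Z ω * (W ω * X ω) = X ω * Y ω * (Z ω * W ω) := fun ω => by ring
  have e2 : ∀ p, g p * h p * (k p * f p) = f p * g p * (h p * k p) := fun p => by ring
  simp_rw [e1, e2, mul_comm (k _) (f _), mul_comm (h _) (f _), mul_comm (g _) (f _)]
  rw [H]
  ring

variable {S : Set (Set E)}

theorem IsSimpleIntegral.memLp (hc : IsCenteredField c μ P κ)
    (hS : ∀ A ∈ S, MeasurableSet A ∧ μ A < ∞) {X : Ω → ℝ} {f : E → ℝ}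
    (hX : IsSimpleIntegral c P S X f) : MemLp X 4 P := by
  induction hX with
  | of hA => exact hc.memLp _ (hS _ hA).1 (hS _ hA).2
  | zero => exact MemLp.zero
  | add _ _ ihX ihY => exact ihX.add ihY
  | neg _ ih => exact ih.neg
  | congr _ h ih => exact (memLp_congr_ae h).1 ih

theorem IsSimpleIntegral.memLp_fun (hS : ∀ A ∈ S, MeasurableSet A ∧ μ A < ∞) {X : Ω → ℝ}
    {f : E → ℝ} (hX : IsSimpleIntegral c P S X f) (p : ℝ≥0∞) : MemLp f p μ := by
  induction hX with
  | of hA => exact memLp_indicator_const p (hS _ hA).1 1 (Or.inr (hS _ hA).2.ne)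
  | zero => exact MemLp.zero
  | add _ _ ihX ihY => exact ihX.add ihY
  | neg _ ih => exact ih.neg
  | congr _ h ih => exact ih

/-- Both sides of the identity are linear in the first slot, so indicators suffice there. -/
theorem IsSimpleIntegral.fourthMomentIdentity_of_forall
    (hc : IsCenteredField c μ P κ) (hS : ∀ A ∈ S, MeasurableSet A ∧ μ A < ∞)
    {X Y Z W : Ω → ℝ} {f g h k : E → ℝ} (hX : IsSimpleIntegral c P S X f) (hY : MemLp Y 4 P)
    (hZ : MemLp Z 4 P) (hW : MemLp W 4 P) (hg : ∀ p, MemLp g p μ) (hh : ∀ p, MemLp h p μ)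
    (hk : ∀ p, MemLp k p μ)
    (H : ∀ A ∈ S, FourthMomentIdentity κ P μ (c A) Y Z W (A.indicator 1) g h k) :
    FourthMomentIdentity κ P μ X Y Z W f g h k := by
  induction hX with
  | of hA => exact H _ hA
  | zero => simp [FourthMomentIdentity]
  | @add X₁ X₂ f₁ f₂ h₁ h₂ ih₁ ih₂ =>
    have iX : ∀ {X : Ω → ℝ} {f : E → ℝ}, IsSimpleIntegral c P S X f →
        Integrable (fun ω => X ω * Y ω * (Z ω * W ω)) P := fun hX =>
      (hX.memLp hc hS).integrable_mul_of_four hY hZ hW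
    have if4 : ∀ {X : Ω → ℝ} {f : E → ℝ}, IsSimpleIntegral c P S X f →
        Integrable (fun p => f p * g p * (h p * k p)) μ := fun hX =>
      (hX.memLp_fun hS 4).integrable_mul_of_four (hg 4) (hh 4) (hk 4)
    have if2 : ∀ {X : Ω → ℝ} {f : E → ℝ}, IsSimpleIntegral c P S X f → ∀ {u : E → ℝ},
        (∀ p, MemLp u p μ) → Integrable (fun p => f p * u p) μ := fun hX _ hu =>
      (hX.memLp_fun hS 2).integrable_mul (hu 2)
    unfold FourthMomentIdentity at ih₁ ih₂ ⊢
    simp only [Pi.add_apply, add_mul]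
    rw [integral_add (iX h₁) (iX h₂), integral_add (if4 h₁) (if4 h₂),
      integral_add (if2 h₁ hg) (if2 h₂ hg), integral_add (if2 h₁ hh) (if2 h₂ hh),
      integral_add (if2 h₁ hk) (if2 h₂ hk), ih₁, ih₂]
    ring
  | neg _ ih =>
    unfold FourthMomentIdentity at ih ⊢
    simp only [Pi.neg_apply, neg_mul, integral_neg]
    rw [ih]
    ring
  | congr _ hX ih =>
    unfold FourthMomentIdentity at ih ⊢
    rw [← ih]
    refine integral_congr_ae ?_
    filter_upwards [hX] with ω hω
    rw [hω]

/-- The sets are pairwise equal or disjoint, so only the pattern of coincidences matters. Four equal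
sets give `κ μ(A) + 3 μ(A)²`, two distinct pairs give the product of the measures, and in every
other pattern both sides vanish. -/
theorem IsCenteredField.fourthMomentIdentity_indicator (hc : IsCenteredField c μ P κ)
    (hS : ∀ A ∈ S, MeasurableSet A ∧ μ A < ∞) (hSd : S.PairwiseDisjoint id)
    (hA : A ∈ S) (hB : B ∈ S) (hC : C ∈ S) (hD : D ∈ S) :
    FourthMomentIdentity κ P μ (c A) (c B) (c C) (c D) (A.indicator 1) (B.indicator 1)
      (C.indicator 1) (D.indicator 1) := by
  have hdis : ∀ {A B : Set E}, A ∈ S → B ∈ S → A ≠ B → Disjoint A B := fun hA hB h => hSd hA hB h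
  have hone : ∀ A ∈ S, ∫ p, A.indicator (1 : E → ℝ) p ∂μ = μ.real A := fun A hA =>
    integral_indicator_one (hS A hA).1
  have hmul : ∀ A : Set E, ∀ p, A.indicator (1 : E → ℝ) p * A.indicator 1 p = A.indicator 1 p :=
    fun A p => by by_cases h : p ∈ A <;> simp [h]
  have hmul0 : ∀ {A B : Set E}, A ∈ S → B ∈ S → A ≠ B →
      ∀ p, A.indicator (1 : E → ℝ) p * B.indicator 1 p = 0 := fun hA hB h p => by
    rw [← inter_indicator_mul, disjoint_iff_inter_eq_empty.1 (hdis hA hB h)]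
    simp
  have m4 := fun A hA => hc.fourth A (hS A hA).1 (hS A hA).2
  have m2 := fun A hA => hc.second A (hS A hA).1 (hS A hA).2
  have m31 : ∀ {A B : Set E}, A ∈ S → B ∈ S → A ≠ B → ∫ ω, c A ω ^ 3 * c B ω ^ 1 ∂P = 0 :=
    fun hA hB h => by
      rw [hc.integral_pow_mul_pow (hS _ hA).1 (hS _ hB).1 (hS _ hA).2 (hS _ hB).2 (hdis hA hB h)]
      simp [hc.mean _ (hS _ hB).1 (hS _ hB).2]
  have m22 : ∀ {A B : Set E}, A ∈ S → B ∈ S → A ≠ B →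
      ∫ ω, c A ω ^ 2 * c B ω ^ 2 ∂P = μ.real A * μ.real B :=
    fun hA hB h => by
      rw [hc.integral_pow_mul_pow (hS _ hA).1 (hS _ hB).1 (hS _ hA).2 (hS _ hB).2 (hdis hA hB h),
        m2 _ hA, m2 _ hB]
  have m211 : ∀ {A B C : Set E}, A ∈ S → B ∈ S → C ∈ S → A ≠ B → A ≠ C → B ≠ C →
      ∫ ω, c A ω ^ 2 * (c B ω * c C ω) ∂P = 0 := fun hA hB hC h1 h2 h3 =>
    hc.integral_sq_mul_mul (hS _ hA).1 (hS _ hB).1 (hS _ hC).1 (hS _ hA).2 (hS _ hB).2 (hS _ hC).2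
      (hdis hA hB h1) (hdis hA hC h2) (hdis hB hC h3)
  unfold FourthMomentIdentity
  by_cases hAB : A = B
  · subst hAB
    by_cases hAC : A = C
    · subst hAC
      by_cases hAD : A = D
      · subst hAD
        simp only [hmul, hone _ hA]
        rw [integral_congr_ae (Eventually.of_forall fun ω => show _ = c A ω ^ 4 by ring), m4 A hA]
        ring
      · simp only [hmul, hmul0 hA hD hAD, mul_zero, integral_zero]
        rw [integral_congr_ae (Eventually.of_forall fun ω =>
          show _ = c A ω ^ 3 * c D ω ^ 1 by ring), m31 hA hD hAD]
        ring
    · by_cases hAD : A = D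
      · subst hAD
        simp only [hmul, hmul0 hA hC hAC, hmul0 hC hA (Ne.symm hAC), mul_zero, integral_zero]
        rw [integral_congr_ae (Eventually.of_forall fun ω =>
          show _ = c A ω ^ 3 * c C ω ^ 1 by ring), m31 hA hC hAC]
        ring
      · by_cases hCD : C = D
        · subst hCD
          simp only [hmul, hmul0 hA hC hAC, mul_zero, integral_zero, hone _ hA, hone _ hC]
          rw [integral_congr_ae (Eventually.of_forall fun ω =>
            show _ = c A ω ^ 2 * c C ω ^ 2 by ring), m22 hA hC hAC]
          ring
        · simp only [hmul, hmul0 hA hC hAC, hmul0 hA hD hAD, hmul0 hC hD hCD, mul_zero,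
            integral_zero]
          rw [integral_congr_ae (Eventually.of_forall fun ω =>
            show _ = c A ω ^ 2 * (c C ω * c D ω) by ring), m211 hA hC hD hAC hAD hCD]
          ring
  · by_cases hAC : A = C
    · subst hAC
      have hBA := Ne.symm hAB
      by_cases hAD : A = D
      · subst hAD
        simp only [hmul, hmul0 hA hB hAB, hmul0 hB hA hBA, mul_zero, zero_mul, integral_zero]
        rw [integral_congr_ae (Eventually.of_forall fun ω =>
          show _ = c A ω ^ 3 * c B ω ^ 1 by ring), m31 hA hB hAB]
        ring
      · by_cases hBD : B = D
        · subst hBD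
          simp only [hmul, hmul0 hA hB hAB, hmul0 hB hA hBA, mul_zero, integral_zero, hone _ hA,
            hone _ hB]
          rw [integral_congr_ae (Eventually.of_forall fun ω =>
            show _ = c A ω ^ 2 * c B ω ^ 2 by ring), m22 hA hB hAB]
          ring
        · simp only [hmul, hmul0 hA hB hAB, hmul0 hA hD hAD, hmul0 hB hD hBD, mul_zero, zero_mul,
            integral_zero]
          rw [integral_congr_ae (Eventually.of_forall fun ω =>
            show _ = c A ω ^ 2 * (c B ω * c D ω) by ring), m211 hA hB hD hAB hAD hBD]
          ring
    · by_cases hBC : B = C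
      · subst hBC
        by_cases hAD : A = D
        · subst hAD
          simp only [hmul, hmul0 hA hB hAB, hmul0 hB hA (Ne.symm hAB), mul_zero,
            integral_zero, hone _ hA, hone _ hB]
          rw [integral_congr_ae (Eventually.of_forall fun ω =>
            show _ = c A ω ^ 2 * c B ω ^ 2 by ring), m22 hA hB hAB]
          ring
        · by_cases hBD : B = D
          · subst hBD
            simp only [hmul, hmul0 hA hB hAB, mul_zero, zero_mul, integral_zero]
            rw [integral_congr_ae (Eventually.of_forall fun ω =>
              show _ = c B ω ^ 3 * c A ω ^ 1 by ring), m31 hB hA (Ne.symm hAB)]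
            ring
          · simp only [hmul, hmul0 hA hB hAB, hmul0 hA hD hAD, hmul0 hB hD hBD, mul_zero, zero_mul,
              integral_zero]
            rw [integral_congr_ae (Eventually.of_forall fun ω =>
              show _ = c B ω ^ 2 * (c A ω * c D ω) by ring),
              m211 hB hA hD (Ne.symm hAB) hBD hAD]
            ring
      · have hab := hmul0 hA hB hAB
        have hac := hmul0 hA hC hAC
        have hbc := hmul0 hB hC hBC
        simp only [hab, hac, hbc, mul_zero, zero_mul, integral_zero, add_zero]
        by_cases hAD : A = D
        · subst hAD
          rw [integral_congr_ae (Eventually.of_forall fun ω =>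
            show _ = c A ω ^ 2 * (c B ω * c C ω) by ring), m211 hA hB hC hAB hAC hBC]
        · by_cases hBD : B = D
          · subst hBD
            rw [integral_congr_ae (Eventually.of_forall fun ω =>
              show _ = c B ω ^ 2 * (c A ω * c C ω) by ring),
              m211 hB hA hC (Ne.symm hAB) hBC hAC]
          · by_cases hCD : C = D
            · subst hCD
              rw [integral_congr_ae (Eventually.of_forall fun ω =>
                show _ = c C ω ^ 2 * (c A ω * c B ω) by ring),
                m211 hC hA hB (Ne.symm hAC) (Ne.symm hBC) hAB]
            · exact hc.integral_mul_mul_mul (hS _ hA).1 (hS _ hB).1 (hS _ hC).1 (hS _ hD).1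
                (hS _ hA).2 (hS _ hB).2 (hS _ hC).2 (hS _ hD).2 (hdis hA hB hAB) (hdis hA hC hAC)
                (hdis hA hD hAD) (hdis hB hC hBC) (hdis hB hD hBD) (hdis hC hD hCD)

theorem IsSimpleIntegral.fourthMomentIdentity (hc : IsCenteredField c μ P κ)
    (hS : ∀ A ∈ S, MeasurableSet A ∧ μ A < ∞) (hSd : S.PairwiseDisjoint id)
    {X Y Z W : Ω → ℝ} {f g h k : E → ℝ} (hX : IsSimpleIntegral c P S X f)
    (hY : IsSimpleIntegral c P S Y g) (hZ : IsSimpleIntegral c P S Z h)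
    (hW : IsSimpleIntegral c P S W k) : FourthMomentIdentity κ P μ X Y Z W f g h k := by
  have hcL : ∀ A ∈ S, MemLp (c A) 4 P := fun A hA => hc.memLp A (hS A hA).1 (hS A hA).2
  have hiL : ∀ A ∈ S, ∀ p, MemLp (A.indicator (1 : E → ℝ)) p μ := fun A hA p =>
    (IsSimpleIntegral.of (c := c) (P := P) hA).memLp_fun hS p
  refine hX.fourthMomentIdentity_of_forall hc hS (hY.memLp hc hS) (hZ.memLp hc hS)
    (hW.memLp hc hS) (hY.memLp_fun hS) (hZ.memLp_fun hS) (hW.memLp_fun hS) fun A hA => ?_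
  -- Undoing three rotations brings the next variable to the first slot and sends the indicator to
  -- the last.
  refine FourthMomentIdentity.rotate (FourthMomentIdentity.rotate (FourthMomentIdentity.rotate ?_))
  refine hY.fourthMomentIdentity_of_forall hc hS (hZ.memLp hc hS) (hW.memLp hc hS) (hcL A hA)
    (hZ.memLp_fun hS) (hW.memLp_fun hS) (hiL A hA) fun B hB => ?_
  refine FourthMomentIdentity.rotate (FourthMomentIdentity.rotate (FourthMomentIdentity.rotate ?_))
  refine hZ.fourthMomentIdentity_of_forall hc hS (hW.memLp hc hS) (hcL A hA) (hcL B hB)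
    (hW.memLp_fun hS) (hiL A hA) (hiL B hB) fun C hC => ?_
  refine FourthMomentIdentity.rotate (FourthMomentIdentity.rotate (FourthMomentIdentity.rotate ?_))
  refine hW.fourthMomentIdentity_of_forall hc hS (hcL A hA) (hcL B hB) (hcL C hC)
    (hiL A hA) (hiL B hB) (hiL C hC) fun D hD => ?_
  exact (hc.fourthMomentIdentity_indicator hS hSd hA hB hC hD).rotate.rotate.rotate

theorem IsSimpleIntegral.integral_mul_of_forall [IsProbabilityMeasure P]
    (hc : IsCenteredField c μ P κ) (hS : ∀ A ∈ S, MeasurableSet A ∧ μ A < ∞)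
    {X Y : Ω → ℝ} {f g : E → ℝ} (hX : IsSimpleIntegral c P S X f) (hY : MemLp Y 4 P)
    (hg : MemLp g 2 μ)
    (H : ∀ A ∈ S, ∫ ω, c A ω * Y ω ∂P = ∫ p, A.indicator 1 p * g p ∂μ) :
    ∫ ω, X ω * Y ω ∂P = ∫ p, f p * g p ∂μ := by
  have hY2 : MemLp Y 2 P := hY.mono_exponent (by norm_num)
  induction hX with
  | of hA => exact H _ hA
  | zero => simp
  | add h₁ h₂ ih₁ ih₂ =>
    have iX : ∀ {X : Ω → ℝ} {f : E → ℝ}, IsSimpleIntegral c P S X f →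
        Integrable (fun ω => X ω * Y ω) P := fun hX =>
      MemLp.integrable_mul (p := 2) (q := 2)
        ((hX.memLp hc hS).mono_exponent (by norm_num)) hY2
    have if2 : ∀ {X : Ω → ℝ} {f : E → ℝ}, IsSimpleIntegral c P S X f →
        Integrable (fun p => f p * g p) μ := fun hX =>
      (hX.memLp_fun hS 2).integrable_mul hg
    simp only [Pi.add_apply, add_mul]
    rw [integral_add (iX h₁) (iX h₂), integral_add (if2 h₁) (if2 h₂), ih₁, ih₂]
  | neg _ ih =>
    simp only [Pi.neg_apply, neg_mul, integral_neg]
    rw [ih]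
  | congr _ hX ih =>
    rw [← ih]
    refine integral_congr_ae ?_
    filter_upwards [hX] with ω hω
    rw [hω]

theorem IsSimpleIntegral.integral_mul [IsProbabilityMeasure P] (hc : IsCenteredField c μ P κ)
    (hS : ∀ A ∈ S, MeasurableSet A ∧ μ A < ∞) (hSd : S.PairwiseDisjoint id)
    {X Y : Ω → ℝ} {f g : E → ℝ} (hX : IsSimpleIntegral c P S X f)
    (hY : IsSimpleIntegral c P S Y g) : ∫ ω, X ω * Y ω ∂P = ∫ p, f p * g p ∂μ := by
  refine hX.integral_mul_of_forall hc hS (hY.memLp hc hS) (hY.memLp_fun hS 2) fun A hA => ?_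
  simp_rw [mul_comm (c A _), mul_comm (A.indicator 1 _)]
  refine hY.integral_mul_of_forall hc hS (hc.memLp A (hS A hA).1 (hS A hA).2)
    ((IsSimpleIntegral.of (c := c) (P := P) hA).memLp_fun hS 2) fun B hB => ?_
  by_cases hBA : B = A
  · subst hBA
    simp_rw [← inter_indicator_mul, inter_self, ← pow_two]
    rw [hc.second B (hS B hB).1 (hS B hB).2, ← integral_indicator_one (hS B hB).1]
    simp only [Pi.one_def, one_pow]
  · have hd : Disjoint B A := hSd hB hA hBA
    simp_rw [← inter_indicator_mul, disjoint_iff_inter_eq_empty.1 hd]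
    rw [hc.integral_mul_of_disjoint (hS B hB).1 (hS A hA).1 (hS B hB).2 (hS A hA).2 hd]
    simp

/-- The atoms of the finite family `B` of sets inside its union. -/
def atomOf {ι : Type*} (B : ι → Set E) (s : Finset ι) : Set E :=
  {p | (∀ i, p ∈ B i ↔ i ∈ s) ∧ s.Nonempty}

omit [MeasurableSpace E] in
theorem pairwiseDisjoint_range_atomOf {ι : Type*} (B : ι → Set E) :
    (range (atomOf B)).PairwiseDisjoint id := by
  rintro _ ⟨s, rfl⟩ _ ⟨t, rfl⟩ hst
  refine Set.disjoint_left.2 fun p hp hq => hst ?_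
  have : s = t := Finset.ext fun i => (hp.1 i).symm.trans (hq.1 i)
  rw [this]

theorem measurableSet_atomOf {ι : Type*} [Finite ι] {B : ι → Set E}
    (hB : ∀ i, MeasurableSet (B i)) (s : Finset ι) : MeasurableSet (atomOf B s) := by
  classical
  have : atomOf B s = (⋂ i, if i ∈ s then B i else (B i)ᶜ) ∩ {_p | s.Nonempty} := by
    ext p
    simp only [atomOf, mem_ofPred_eq, mem_inter_iff, mem_iInter]
    refine and_congr_left fun _ => forall_congr' fun i => ?_
    split_ifs with h <;> simp [h]
  rw [this]
  refine (MeasurableSet.iInter fun i => ?_).inter (MeasurableSet.const _)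
  split_ifs
  exacts [hB i, (hB i).compl]

/-- The nonemptiness condition in `atomOf` discards the complement of the union, the one cell whose
measure need not be finite. -/
theorem measure_atomOf_lt_top {ι : Type*} {B : ι → Set E} (hB : ∀ i, μ (B i) < ∞)
    (s : Finset ι) : μ (atomOf B s) < ∞ := by
  rcases s.eq_empty_or_nonempty with rfl | ⟨i, hi⟩
  · simp [atomOf]
  · exact (measure_mono fun p hp => (hp.1 i).2 hi).trans_lt (hB i)

theorem IsCenteredField.isSimpleIntegral_biUnion (hc : IsCenteredField c μ P κ)
    (hS : ∀ A ∈ S, MeasurableSet A ∧ μ A < ∞) {ι : Type*} (A : ι → Set E) (T : Finset ι)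
    (hA : ∀ i ∈ T, A i ∈ S) (hd : (T : Set ι).PairwiseDisjoint A) :
    IsSimpleIntegral c P S (c (⋃ i ∈ T, A i)) ((⋃ i ∈ T, A i).indicator 1) := by
  classical
  induction T using Finset.induction_on with
  | empty =>
    simp only [Finset.notMem_empty, iUnion_of_empty, iUnion_empty, indicator_empty]
    exact IsSimpleIntegral.zero.congr hc.empty_ae.symm
  | insert a T ha ih =>
    have hT : ∀ i ∈ T, A i ∈ S := fun i hi => hA i (Finset.mem_insert_of_mem hi)
    have ha' := hA a (Finset.mem_insert_self a T)
    have h := ih hT (hd.subset (by simp))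
    have hdis : Disjoint (A a) (⋃ i ∈ T, A i) := by
      refine disjoint_iUnion₂_right.2 fun i hi => hd (by simp) (by simp [hi]) ?_
      rintro rfl
      exact ha hi
    have hm : MeasurableSet (⋃ i ∈ T, A i) := T.measurableSet_biUnion fun i hi => (hS _ (hT i hi)).1
    have hf : μ (⋃ i ∈ T, A i) < ∞ :=
      measure_biUnion_lt_top T.finite_toSet fun i hi => (hS _ (hT i hi)).2
    rw [Finset.set_biUnion_insert, indicator_union_of_disjoint hdis]
    exact ((IsSimpleIntegral.of ha').add h).congr
      (hc.add _ _ (hS _ ha').1 hm (hS _ ha').2 hf hdis).symm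

/-- `B i` is the disjoint union of the atoms whose index set contains `i`. Thus finitely many
overlapping sets are handled through one disjoint family. -/
theorem IsCenteredField.isSimpleIntegral_atomOf (hc : IsCenteredField c μ P κ) {ι : Type*}
    [Fintype ι] {B : ι → Set E} (hB : ∀ i, MeasurableSet (B i)) (hB' : ∀ i, μ (B i) < ∞) (i : ι) :
    IsSimpleIntegral c P (range (atomOf B)) (c (B i)) ((B i).indicator 1) := by
  classical
  have hU : B i = ⋃ s ∈ Finset.univ.filter (fun s : Finset ι => i ∈ s), atomOf B s := by
    ext p
    simp only [Finset.mem_filter, Finset.mem_univ, true_and, mem_iUnion, exists_prop]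
    constructor
    · intro h
      refine ⟨Finset.univ.filter fun j => p ∈ B j, by simpa, fun j => by simp, ⟨i, by simpa⟩⟩
    · rintro ⟨s, hs, hp⟩
      exact (hp.1 i).2 hs
  have := hc.isSimpleIntegral_biUnion (S := range (atomOf B)) (by
    rintro _ ⟨s, rfl⟩
    exact ⟨measurableSet_atomOf hB s, measure_atomOf_lt_top hB' s⟩) (atomOf B)
    (Finset.univ.filter fun s : Finset ι => i ∈ s) (fun s _ => ⟨s, rfl⟩) (by
      intro s _ t _ hst
      refine Set.disjoint_left.2 fun p hp hq => hst ?_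
      exact Finset.ext fun i => (hp.1 i).symm.trans (hq.1 i))
  rwa [← hU] at this

end FourthMoments

/-! ### Variance of a sum of products -/

section VarianceBound

variable {E Ω : Type*} [MeasurableSpace E] [MeasurableSpace Ω] {P : Measure Ω}
  [IsProbabilityMeasure P] {μ : Measure E} {c : Set E → Ω → ℝ} {κ : ℝ} {S : Set (Set E)}

theorem sum_integral_abs_mul_abs_le {N : ℕ} {f : E → ℝ} {v : ℕ → E → ℝ} (hf : MemLp f 2 μ)
    (hf1 : MemLp f 1 μ) (hv : ∀ k < N, MemLp (v k) 2 μ)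
    (hv2 : ∀ p, ∑ k ∈ Finset.range N, |v k p| ≤ 2) :
    ∑ k ∈ Finset.range N, ∫ p, |f p| * |v k p| ∂μ ≤ 2 * ∫ p, |f p| ∂μ := by
  have hi : ∀ k ∈ Finset.range N, Integrable (fun p => |f p| * |v k p|) μ := fun k hk =>
    hf.abs.integrable_mul (hv k (Finset.mem_range.1 hk)).abs
  rw [← integral_finsetSum _ hi, ← integral_const_mul]
  refine integral_mono (integrable_finsetSum _ hi)
    ((memLp_one_iff_integrable.1 hf1.abs).const_mul 2) fun p => ?_
  simp only
  rw [← Finset.mul_sum, mul_comm]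
  exact mul_le_mul_of_nonneg_right (hv2 p) (abs_nonneg _)

theorem abs_integral_mul_le_of_abs_le_one {f g : E → ℝ} (hf : MemLp f 1 μ)
    (hg : ∀ p, |g p| ≤ 1) : |∫ p, f p * g p ∂μ| ≤ ∫ p, |f p| ∂μ := by
  refine abs_integral_le_integral_abs.trans ?_
  refine integral_mono_of_nonneg (Eventually.of_forall fun p => abs_nonneg _)
    (memLp_one_iff_integrable.1 hf.abs) (Eventually.of_forall fun p => ?_)
  simp only [abs_mul]
  exact mul_le_of_le_one_right (abs_nonneg _) (hg p)

/-- In the covariance of `U_j V_j` and `U_k V_k` the pairing `⟨u_j,v_j⟩⟨u_k,v_k⟩` cancels. The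
remaining terms are at most `(κ + G) ∫ |v_j||v_k| + m ∫ |u_j||v_k|`. Summing over `k` inside the
integral, where `∑ |v_k| ≤ 2`, bounds each row by `2m(κ + G) + 2mG`; there are `N` rows. -/
theorem IsSimpleIntegral.integral_sum_mul_sub_sq_le (hc : IsCenteredField c μ P κ)
    (hS : ∀ A ∈ S, MeasurableSet A ∧ μ A < ∞) (hSd : S.PairwiseDisjoint id)
    {N : ℕ} {U V : ℕ → Ω → ℝ} {u v : ℕ → E → ℝ}
    (hU : ∀ k < N, IsSimpleIntegral c P S (U k) (u k))
    (hV : ∀ k < N, IsSimpleIntegral c P S (V k) (v k)) {G m : ℝ}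
    (hu : ∀ k < N, ∀ p, |u k p| ≤ 1) (hv : ∀ p, ∑ k ∈ Finset.range N, |v k p| ≤ 2)
    (huG : ∀ k < N, ∫ p, |u k p| ∂μ ≤ G) (hvm : ∀ k < N, ∫ p, |v k p| ∂μ ≤ m) :
    ∫ ω, (∑ k ∈ Finset.range N, U k ω * V k ω -
      ∑ k ∈ Finset.range N, ∫ p, u k p * v k p ∂μ) ^ 2 ∂P ≤ N * (m * (2 * κ + 4 * G)) := by
  have hUL := fun k hk => (hU k hk).memLp hc hS
  have hVL := fun k hk => (hV k hk).memLp hc hS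
  have huL := fun k hk => (hU k hk).memLp_fun (μ := μ) hS
  have hvL := fun k hk => (hV k hk).memLp_fun (μ := μ) hS
  set M : Ω → ℝ := fun ω => ∑ k ∈ Finset.range N, U k ω * V k ω with hM
  set A : ℝ := ∑ k ∈ Finset.range N, ∫ p, u k p * v k p ∂μ with hA
  have hML : MemLp M 2 P := by
    have := memLp_finsetSum (Finset.range N) (f := fun k ω => U k ω * V k ω) (p := 2) (μ := P)
      fun k hk => (hUL k (Finset.mem_range.1 hk)).mul_of_four (hVL k (Finset.mem_range.1 hk))
    convert this using 1
  have hMi : ∫ ω, M ω ∂P = A := by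
    rw [hM, integral_finsetSum _ fun k hk => ((hUL k (Finset.mem_range.1 hk)).mul_of_four
      (hVL k (Finset.mem_range.1 hk))).integrable (by norm_num)]
    exact Finset.sum_congr rfl fun k hk =>
      (hU k (Finset.mem_range.1 hk)).integral_mul hc hS hSd (hV k (Finset.mem_range.1 hk))
  have hsq : ∫ ω, (M ω - A) ^ 2 ∂P = ∫ ω, M ω ^ 2 ∂P - A ^ 2 := by
    have e : ∀ ω, (M ω - A) ^ 2 = M ω ^ 2 + ((-2 * A) * M ω + A ^ 2) := fun ω => by ring
    have i1 : Integrable (fun ω => (-2 * A) * M ω) P :=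
      (hML.integrable (by norm_num)).const_mul _
    simp_rw [e]
    rw [integral_add hML.integrable_sq (i1.fun_add (integrable_const _)),
      integral_add i1 (integrable_const _), integral_const_mul, hMi]
    simp
    ring
  have hM2 : ∫ ω, M ω ^ 2 ∂P = ∑ j ∈ Finset.range N, ∑ k ∈ Finset.range N,
      ∫ ω, U j ω * V j ω * (U k ω * V k ω) ∂P := by
    simp_rw [hM, pow_two, Finset.sum_mul_sum]
    have hi : ∀ j ∈ Finset.range N, ∀ k ∈ Finset.range N,
        Integrable (fun ω => U j ω * V j ω * (U k ω * V k ω)) P := fun j hj k hk =>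
      (hUL j (Finset.mem_range.1 hj)).integrable_mul_of_four (hVL j (Finset.mem_range.1 hj))
        (hUL k (Finset.mem_range.1 hk)) (hVL k (Finset.mem_range.1 hk))
    rw [integral_finsetSum _ fun j hj => integrable_finsetSum _ (hi j hj)]
    exact Finset.sum_congr rfl fun j hj => integral_finsetSum _ (hi j hj)
  have hA2 : A ^ 2 = ∑ j ∈ Finset.range N, ∑ k ∈ Finset.range N,
      (∫ p, u j p * v j p ∂μ) * ∫ p, u k p * v k p ∂μ := by
    rw [hA, pow_two, Finset.sum_mul_sum]
  rw [hsq, hM2, hA2, ← Finset.sum_sub_distrib]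
  have hrow : ∀ j ∈ Finset.range N, (∑ k ∈ Finset.range N,
      ∫ ω, U j ω * V j ω * (U k ω * V k ω) ∂P - ∑ k ∈ Finset.range N,
      (∫ p, u j p * v j p ∂μ) * ∫ p, u k p * v k p ∂μ) ≤ m * (2 * κ + 4 * G) := by
    intro j hj
    have hj' := Finset.mem_range.1 hj
    have hm0 : 0 ≤ m := (integral_nonneg fun p => abs_nonneg _).trans (hvm j hj')
    have hG0 : 0 ≤ G := (integral_nonneg fun p => abs_nonneg _).trans (huG j hj')
    rw [← Finset.sum_sub_distrib]
    have hterm : ∀ k ∈ Finset.range N, ∫ ω, U j ω * V j ω * (U k ω * V k ω) ∂P -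
        (∫ p, u j p * v j p ∂μ) * ∫ p, u k p * v k p ∂μ ≤
        -- Every term keeps a factor `|v k|` under an integral, so that the pointwise bound on `∑ |v
        -- k|` can be used.
        (κ + G) * ∫ p, |v j p| * |v k p| ∂μ + m * ∫ p, |u j p| * |v k p| ∂μ := by
      intro k hk
      have hk' := Finset.mem_range.1 hk
      have H := (hU j hj').fourthMomentIdentity hc hS hSd (hV j hj') (hU k hk') (hV k hk')
      unfold FourthMomentIdentity at H
      have h1 : ∫ p, u j p * v j p * (u k p * v k p) ∂μ ≤ ∫ p, |v j p| * |v k p| ∂μ := by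
        refine integral_mono ((huL j hj' 4).integrable_mul_of_four (hvL j hj' 4) (huL k hk' 4)
          (hvL k hk' 4)) ((hvL j hj' 2).abs.integrable_mul (hvL k hk' 2).abs) fun p => ?_
        refine (le_abs_self _).trans ?_
        simp only [abs_mul]
        exact mul_le_mul (mul_le_of_le_one_left (abs_nonneg _) (hu j hj' p))
          (mul_le_of_le_one_left (abs_nonneg _) (hu k hk' p)) (by positivity) (abs_nonneg _)
      have h2 : (∫ p, u j p * u k p ∂μ) * ∫ p, v j p * v k p ∂μ ≤
          G * ∫ p, |v j p| * |v k p| ∂μ := by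
        refine (le_abs_self _).trans ?_
        rw [abs_mul]
        refine mul_le_mul ((abs_integral_mul_le_of_abs_le_one (huL j hj' 1) (hu k hk')).trans
          (huG j hj')) ?_ (abs_nonneg _) hG0
        simp_rw [← abs_mul]
        exact abs_integral_le_integral_abs
      have h3 : (∫ p, u j p * v k p ∂μ) * ∫ p, v j p * u k p ∂μ ≤
          m * ∫ p, |u j p| * |v k p| ∂μ := by
        refine (le_abs_self _).trans ?_
        rw [abs_mul, mul_comm]
        refine mul_le_mul ((abs_integral_mul_le_of_abs_le_one (hvL j hj' 1) (hu k hk')).trans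
          (hvm j hj')) ?_ (abs_nonneg _) hm0
        simp_rw [← abs_mul]
        exact abs_integral_le_integral_abs
      rw [H]
      linarith [mul_le_mul_of_nonneg_left h1 hc.nonneg]
    refine (Finset.sum_le_sum hterm).trans ?_
    rw [Finset.sum_add_distrib, ← Finset.mul_sum, ← Finset.mul_sum]
    have s1 := sum_integral_abs_mul_abs_le (hvL j hj' 2) (hvL j hj' 1) (fun k hk => hvL k hk 2) hv
    have s2 := sum_integral_abs_mul_abs_le (huL j hj' 2) (huL j hj' 1) (fun k hk => hvL k hk 2) hv
    have t1 := mul_le_mul_of_nonneg_left (s1.trans (mul_le_mul_of_nonneg_left (hvm j hj')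
      zero_le_two)) (add_nonneg hc.nonneg hG0)
    have t2 := mul_le_mul_of_nonneg_left (s2.trans (mul_le_mul_of_nonneg_left (huG j hj')
      zero_le_two)) hm0
    linarith
  refine (Finset.sum_le_sum hrow).trans ?_
  simp

theorem integral_abs_le_sqrt {X : Ω → ℝ} (hX : MemLp X 2 P) {K : ℝ}
    (hK : ∫ ω, X ω ^ 2 ∂P ≤ K) : ∫ ω, |X ω| ∂P ≤ √K := by
  refine Real.le_sqrt_of_sq_le (le_trans ?_ hK)
  have h := variance_nonneg |X| P
  rw [variance_eq_sub hX.abs] at h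
  simp only [Pi.pow_apply, Pi.abs_apply, sq_abs] at h
  linarith

end VarianceBound

/-! ### Geometry of the trawl sets -/

section TrawlSets

/-- The trawl set `A + (t, 0)` at time `t`. -/
def trawlSetAt (a : ℝ → ℝ) (t : ℝ) : Set (ℝ × ℝ) :=
  (fun p => p + (t, 0)) '' trawlSet a

/-- The integral of `a` over `(h, ∞)`; for a trawl function it is the autocovariance at lag `h`
of a trawl process of unit variance. -/
noncomputable def tailIntegral (a : ℝ → ℝ) (h : ℝ) : ℝ :=
  ∫ x in Ioi h, a x

variable {a : ℝ → ℝ}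

theorem mem_trawlSetAt {t : ℝ} {p : ℝ × ℝ} :
    p ∈ trawlSetAt a t ↔ p.1 ≤ t ∧ 0 ≤ p.2 ∧ p.2 ≤ a (t - p.1) := by
  simp only [trawlSetAt, trawlSet, mem_image, mem_ofPred_eq]
  constructor
  · rintro ⟨q, ⟨h1, h2, h3⟩, rfl⟩
    simpa [h1, h2] using h3
  · rintro ⟨h1, h2, h3⟩
    refine ⟨p - (t, 0), ⟨by simpa, by simpa, by simpa⟩, by simp⟩

/-- Nothing is known about `a` at negative arguments; truncating the argument gives a function
continuous on all of `ℝ`, which makes the trawl sets closed. -/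
theorem IsTrawlFunction.continuous_comp_max (ha : IsTrawlFunction a) :
    Continuous fun s => a (max s 0) :=
  ha.continuousOn.comp_continuous (by fun_prop) fun s => le_max_right s 0

theorem IsTrawlFunction.antitone_comp_max (ha : IsTrawlFunction a) :
    Antitone fun s => a (max s 0) := fun _ _ h =>
  ha.antitoneOn (mem_Ici.2 (le_max_right _ _)) (mem_Ici.2 (le_max_right _ _)) (max_le_max_right 0 h)

theorem IsTrawlFunction.measurableSet_region (ha : IsTrawlFunction a) (s t : ℝ) :
    MeasurableSet {p : ℝ × ℝ | p.1 ≤ s ∧ 0 ≤ p.2 ∧ p.2 ≤ a (max (t - p.1) 0)} := by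
  have h := ha.continuous_comp_max
  have h' : Continuous fun p : ℝ × ℝ => a (max (t - p.1) 0) := h.comp (by fun_prop)
  have h1 : IsClosed {p : ℝ × ℝ | p.1 ≤ s} := isClosed_le (by fun_prop) (by fun_prop)
  have h2 : IsClosed {p : ℝ × ℝ | 0 ≤ p.2} := isClosed_le (by fun_prop) (by fun_prop)
  have h3 : IsClosed {p : ℝ × ℝ | p.2 ≤ a (max (t - p.1) 0)} := isClosed_le (by fun_prop) h'
  exact (h1.inter (h2.inter h3)).measurableSet

theorem trawlSetAt_inter_trawlSetAt (ha : IsTrawlFunction a) {s t : ℝ} (hst : s ≤ t) :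
    trawlSetAt a s ∩ trawlSetAt a t =
      {p : ℝ × ℝ | p.1 ≤ s ∧ 0 ≤ p.2 ∧ p.2 ≤ a (max (t - p.1) 0)} := by
  ext p
  simp only [mem_inter_iff, mem_trawlSetAt, mem_ofPred_eq]
  constructor
  · rintro ⟨⟨h1, h2, h3⟩, h4, -, h6⟩
    rw [max_eq_left (by linarith)]
    exact ⟨h1, h2, h6⟩
  · rintro ⟨h1, h2, h3⟩
    rw [max_eq_left (by linarith)] at h3
    refine ⟨⟨h1, h2, h3.trans (ha.antitoneOn ?_ ?_ ?_)⟩, by linarith, h2, h3⟩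
    · simpa using h1
    · simpa using h1.trans hst
    · linarith

theorem measurableSet_trawlSetAt (ha : IsTrawlFunction a) (t : ℝ) :
    MeasurableSet (trawlSetAt a t) := by
  rw [← inter_self (trawlSetAt a t), trawlSetAt_inter_trawlSetAt ha le_rfl]
  exact ha.measurableSet_region t t

theorem IsTrawlFunction.integrableOn_Ioi (ha : IsTrawlFunction a) {h : ℝ} (hh : 0 ≤ h) :
    IntegrableOn a (Ioi h) :=
  ha.integrableOn.mono_set fun _ hx => hh.trans (le_of_lt hx)

/-- For `x ≤ s` the vertical section of the intersection is `[0, a(t - x)]`, the section of the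
later set, since `a` decreases. Reflecting `x ↦ t - x` gives the integral of `a` over `[t - s, ∞)`.
-/
theorem volume_trawlSetAt_inter (ha : IsTrawlFunction a) {s t : ℝ} (hst : s ≤ t) :
    volume (trawlSetAt a s ∩ trawlSetAt a t) = ENNReal.ofReal (tailIntegral a (t - s)) := by
  have hm := ha.measurableSet_region s t
  rw [trawlSetAt_inter_trawlSetAt ha hst, Measure.volume_eq_prod, Measure.prod_apply hm]
  have hsec : ∀ x : ℝ, volume (Prod.mk x ⁻¹'
      {p : ℝ × ℝ | p.1 ≤ s ∧ 0 ≤ p.2 ∧ p.2 ≤ a (max (t - p.1) 0)}) =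
      (Ici (t - s)).indicator (fun y => ENNReal.ofReal (a y)) (t - x) := fun x => by
    by_cases hx : x ≤ s
    · have : Prod.mk x ⁻¹' {p : ℝ × ℝ | p.1 ≤ s ∧ 0 ≤ p.2 ∧ p.2 ≤ a (max (t - p.1) 0)} =
          Icc 0 (a (t - x)) := by
        ext y
        simp [hx, max_eq_left (show 0 ≤ t - x by linarith)]
      rw [this, indicator_of_mem (mem_Ici.2 (by linarith)), Real.volume_Icc, sub_zero]
    · have : Prod.mk x ⁻¹' {p : ℝ × ℝ | p.1 ≤ s ∧ 0 ≤ p.2 ∧ p.2 ≤ a (max (t - p.1) 0)} = ∅ := by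
        ext y
        simp [hx]
      rw [this, indicator_of_notMem (fun h => hx (by linarith [mem_Ici.1 h])), measure_empty]
  simp_rw [hsec]
  have hint := ha.integrableOn_Ioi (sub_nonneg.2 hst)
  rw [lintegral_sub_left_eq_self _ t, lintegral_indicator measurableSet_Ici,
    setLIntegral_congr Ioi_ae_eq_Ici.symm, tailIntegral,
    ofReal_integral_eq_lintegral_ofReal hint]
  filter_upwards [ae_restrict_mem measurableSet_Ioi] with x hx
  exact ha.nonneg x ((sub_nonneg.2 hst).trans (le_of_lt hx))

theorem volume_trawlSetAt (ha : IsTrawlFunction a) (t : ℝ) :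
    volume (trawlSetAt a t) = ENNReal.ofReal (tailIntegral a 0) := by
  rw [← inter_self (trawlSetAt a t), volume_trawlSetAt_inter ha le_rfl, sub_self]

theorem volume_trawlSetAt_lt_top (ha : IsTrawlFunction a) (t : ℝ) :
    volume (trawlSetAt a t) < ∞ := by
  simp [volume_trawlSetAt ha t]

theorem IsTrawlFunction.tailIntegral_nonneg (ha : IsTrawlFunction a) {h : ℝ} (hh : 0 ≤ h) :
    0 ≤ tailIntegral a h :=
  setIntegral_nonneg measurableSet_Ioi fun _ hx => ha.nonneg _ (hh.trans (le_of_lt hx))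

theorem IsTrawlFunction.tailIntegral_sub (ha : IsTrawlFunction a) {s t : ℝ} (hs : 0 ≤ s)
    (hst : s ≤ t) : tailIntegral a s - tailIntegral a t = ∫ x in Ioc s t, a x := by
  have hi := ha.integrableOn_Ioi hs
  rw [tailIntegral, tailIntegral, ← Ioc_union_Ioi_eq_Ioi hst,
    setIntegral_union Ioc_disjoint_Ioi_same measurableSet_Ioi
      (hi.mono_set Ioc_subset_Ioi_self) (hi.mono_set (Ioi_subset_Ioi hst))]
  ring

theorem IsTrawlFunction.tailIntegral_sub_le (ha : IsTrawlFunction a) {s t : ℝ} (hs : 0 ≤ s)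
    (hst : s ≤ t) : tailIntegral a s - tailIntegral a t ≤ (t - s) * a s := by
  rw [ha.tailIntegral_sub hs hst]
  have hi := (ha.integrableOn_Ioi hs).mono_set (Ioc_subset_Ioi_self (a := t) (b := s))
  refine (setIntegral_mono_on hi (integrableOn_const (by simp)) measurableSet_Ioc fun x hx =>
    ha.antitoneOn hs (hs.trans hx.1.le) hx.1.le).trans ?_
  simp [hst]

theorem IsTrawlFunction.le_tailIntegral_sub (ha : IsTrawlFunction a) {s t : ℝ} (hs : 0 ≤ s)
    (hst : s ≤ t) : (t - s) * a t ≤ tailIntegral a s - tailIntegral a t := by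
  rw [ha.tailIntegral_sub hs hst]
  have hi := (ha.integrableOn_Ioi hs).mono_set (Ioc_subset_Ioi_self (a := t) (b := s))
  refine le_trans ?_ (setIntegral_mono_on (integrableOn_const (by simp)) hi measurableSet_Ioc fun x hx =>
    ha.antitoneOn (hs.trans hx.1.le) (hs.trans hst) hx.2)
  simp [hst]

/-- The indicator function of the trawl set at time `t`. -/
noncomputable def trawlIndicator (a : ℝ → ℝ) (t : ℝ) : ℝ × ℝ → ℝ :=
  (trawlSetAt a t).indicator 1

theorem abs_trawlIndicator_le_one (t : ℝ) (p : ℝ × ℝ) : |trawlIndicator a t p| ≤ 1 := by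
  by_cases h : p ∈ trawlSetAt a t <;> simp [trawlIndicator, h]

theorem abs_trawlIndicator_sub_le_one (s t : ℝ) (p : ℝ × ℝ) :
    |trawlIndicator a t p - trawlIndicator a s p| ≤ 1 := by
  by_cases h : p ∈ trawlSetAt a t <;> by_cases h' : p ∈ trawlSetAt a s <;>
    simp [trawlIndicator, h, h']

theorem integrable_trawlIndicator (ha : IsTrawlFunction a) (t : ℝ) :
    Integrable (trawlIndicator a t) :=
  (integrable_indicator_iff (measurableSet_trawlSetAt ha t)).2
    (integrableOn_const (volume_trawlSetAt_lt_top ha t).ne)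

theorem integrable_trawlIndicator_mul (ha : IsTrawlFunction a) (s t : ℝ) :
    Integrable fun p => trawlIndicator a s p * trawlIndicator a t p :=
  (integrable_trawlIndicator ha s).mul_bdd (c := 1)
    (integrable_trawlIndicator ha t).aestronglyMeasurable
    (Eventually.of_forall fun p => abs_trawlIndicator_le_one t p)

theorem integral_trawlIndicator_mul (ha : IsTrawlFunction a) {s t : ℝ} (hst : s ≤ t) :
    ∫ p, trawlIndicator a s p * trawlIndicator a t p = tailIntegral a (t - s) := by
  simp_rw [trawlIndicator, ← inter_indicator_mul, Pi.one_apply, mul_one]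
  have := integral_indicator_one (μ := (volume : Measure (ℝ × ℝ)))
    ((measurableSet_trawlSetAt ha s).inter (measurableSet_trawlSetAt ha t))
  rw [Measure.real, volume_trawlSetAt_inter ha hst,
    ENNReal.toReal_ofReal (ha.tailIntegral_nonneg (sub_nonneg.2 hst))] at this
  exact this

theorem trawlIndicator_mul_self (t : ℝ) (p : ℝ × ℝ) :
    trawlIndicator a t p * trawlIndicator a t p = trawlIndicator a t p := by
  by_cases h : p ∈ trawlSetAt a t <;> simp [trawlIndicator, h]

theorem integral_trawlIndicator_sub_mul_self (ha : IsTrawlFunction a) {s t : ℝ} (hst : s ≤ t) :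
    ∫ p, (trawlIndicator a t p - trawlIndicator a s p) *
      (trawlIndicator a t p - trawlIndicator a s p) =
      2 * (tailIntegral a 0 - tailIntegral a (t - s)) := by
  have e : ∀ p, (trawlIndicator a t p - trawlIndicator a s p) *
      (trawlIndicator a t p - trawlIndicator a s p) =
      trawlIndicator a t p * trawlIndicator a t p + trawlIndicator a s p * trawlIndicator a s p -
      2 * (trawlIndicator a s p * trawlIndicator a t p) := fun p => by ring
  have i := integrable_trawlIndicator_mul ha
  simp_rw [e]
  rw [integral_sub ((i t t).fun_add (i s s)) ((i s t).const_mul 2), integral_add (i t t) (i s s),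
    integral_const_mul, integral_trawlIndicator_mul ha hst, integral_trawlIndicator_mul ha le_rfl,
    integral_trawlIndicator_mul ha le_rfl, sub_self, sub_self]
  ring

/-- The difference takes values in `{-1, 0, 1}`, so its `L¹` norm is its squared `L²` norm, which
`Γ` expresses. -/
theorem abs_trawlIndicator_sub (s t : ℝ) (p : ℝ × ℝ) :
    |trawlIndicator a t p - trawlIndicator a s p| =
      (trawlIndicator a t p - trawlIndicator a s p) *
      (trawlIndicator a t p - trawlIndicator a s p) := by
  by_cases h : p ∈ trawlSetAt a t <;> by_cases h' : p ∈ trawlSetAt a s <;>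
    simp [trawlIndicator, h, h']

theorem integral_abs_trawlIndicator_sub_le (ha : IsTrawlFunction a) {s t : ℝ} (hst : s ≤ t) :
    ∫ p, |trawlIndicator a t p - trawlIndicator a s p| ≤ 2 * ((t - s) * a 0) := by
  simp_rw [abs_trawlIndicator_sub]
  rw [integral_trawlIndicator_sub_mul_self ha hst]
  have := ha.tailIntegral_sub_le le_rfl (sub_nonneg.2 hst)
  rw [sub_zero] at this
  linarith

theorem integral_abs_trawlIndicator_sub_le_tailIntegral (ha : IsTrawlFunction a) {s t : ℝ}
    (hst : s ≤ t) :
    ∫ p, |trawlIndicator a t p - trawlIndicator a s p| ≤ 2 * tailIntegral a 0 := by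
  simp_rw [abs_trawlIndicator_sub]
  rw [integral_trawlIndicator_sub_mul_self ha hst]
  linarith [ha.tailIntegral_nonneg (sub_nonneg.2 hst)]

theorem integral_abs_trawlIndicator (ha : IsTrawlFunction a) (t : ℝ) :
    ∫ p, |trawlIndicator a t p| = tailIntegral a 0 := by
  rw [← sub_self t, ← integral_trawlIndicator_mul ha (le_refl t)]
  refine integral_congr_ae (Eventually.of_forall fun p => ?_)
  simp only [trawlIndicator_mul_self]
  exact abs_of_nonneg (indicator_nonneg (fun _ _ => zero_le_one) p)

theorem integral_trawlIndicator_mul_sub (ha : IsTrawlFunction a) {s t t' : ℝ} (hst : s ≤ t)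
    (htt : t ≤ t') :
    ∫ p, trawlIndicator a s p * (trawlIndicator a t' p - trawlIndicator a t p) =
      tailIntegral a (t' - s) - tailIntegral a (t - s) := by
  simp_rw [mul_sub]
  rw [integral_sub (integrable_trawlIndicator_mul ha _ _) (integrable_trawlIndicator_mul ha _ _),
    integral_trawlIndicator_mul ha hst, integral_trawlIndicator_mul ha (hst.trans htt)]

/-- Each increment of the product is at most the rise of `u` plus the fall of `v`, and each of these
telescopes to at most `1`. -/
theorem sum_abs_sub_le_of_monotone_mul_antitone {u v x : ℕ → ℝ} (hu : Monotone u)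
    (hv : Antitone v) (hu01 : ∀ k, u k ∈ Icc (0 : ℝ) 1) (hv01 : ∀ k, v k ∈ Icc (0 : ℝ) 1)
    (hx : ∀ k, x k = u k * v k) (N : ℕ) :
    ∑ k ∈ Finset.range N, |x (k + 1) - x k| ≤ 2 := by
  have hk : ∀ k ∈ Finset.range N, |x (k + 1) - x k| ≤ (u (k + 1) - u k) + (v k - v (k + 1)) := by
    intro k _
    have h1 := hu (Nat.le_succ k)
    have h2 := hv (Nat.le_succ k)
    obtain ⟨a0, a1⟩ := hu01 k
    obtain ⟨b0, b1⟩ := hv01 (k + 1)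
    have e : x (k + 1) - x k = (u (k + 1) - u k) * v (k + 1) - u k * (v k - v (k + 1)) := by
      rw [hx, hx]
      ring
    rw [e]
    have m1 := mul_le_of_le_one_right (sub_nonneg.2 h1) b1
    have m2 := mul_le_of_le_one_left (sub_nonneg.2 h2) a1
    have m3 := mul_nonneg (sub_nonneg.2 h1) b0
    have m4 := mul_nonneg a0 (sub_nonneg.2 h2)
    rw [abs_le]
    simp only [Nat.succ_eq_add_one] at *
    constructor <;> linarith
  refine (Finset.sum_le_sum hk).trans ?_
  rw [Finset.sum_add_distrib, Finset.sum_range_sub, Finset.sum_range_sub']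
  have := (hu01 N).2
  have := (hu01 0).1
  have := (hv01 0).2
  have := (hv01 N).1
  linarith

/-- For a fixed point, membership in the moving set is the product of "already entered",
nondecreasing in time, and "not yet left", nonincreasing in time. -/
theorem sum_abs_trawlIndicator_sub_le (ha : IsTrawlFunction a) {τ : ℕ → ℝ} (hτ : Monotone τ)
    (N : ℕ) (p : ℝ × ℝ) :
    ∑ k ∈ Finset.range N, |trawlIndicator a (τ (k + 1)) p - trawlIndicator a (τ k) p| ≤ 2 := by
  classical
  refine sum_abs_sub_le_of_monotone_mul_antitone (x := fun k => trawlIndicator a (τ k) p)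
    (u := fun k => if p.1 ≤ τ k ∧ 0 ≤ p.2 then 1 else 0)
    (v := fun k => if p.2 ≤ a (max (τ k - p.1) 0) then 1 else 0) ?_ ?_ ?_ ?_ ?_ N
  · intro j k hjk
    have := hτ hjk
    dsimp only
    split_ifs with h1 h2
    · exact le_rfl
    · exact absurd ⟨h1.1.trans this, h1.2⟩ h2
    · exact zero_le_one
    · exact le_rfl
  · intro j k hjk
    have := ha.antitone_comp_max (sub_le_sub_right (hτ hjk) p.1)
    dsimp only at this ⊢
    split_ifs with h1 h2
    · exact le_rfl
    · exact absurd (h1.trans this) h2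
    · exact zero_le_one
    · exact le_rfl
  · intro k
    split_ifs <;> simp
  · intro k
    split_ifs <;> simp
  · intro k
    by_cases h : p.1 ≤ τ k
    · rw [trawlIndicator, indicator_apply, max_eq_left (sub_nonneg.2 h)]
      simp only [mem_trawlSetAt, h, true_and]
      by_cases h2 : 0 ≤ p.2 <;> simp [h2]
    · rw [trawlIndicator, indicator_of_notMem (fun h' => h (mem_trawlSetAt.1 h').1)]
      simp [h]

end TrawlSets

/-! ### Concentration of lagged sums and of the quadratic variation -/

section LagSums

variable {Ω : Type*} [MeasurableSpace Ω] {P : Measure Ω}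
  {c : Set (ℝ × ℝ) → Ω → ℝ} {κ : ℝ} {a : ℝ → ℝ}

theorem IsSimpleIntegral.sub {S : Set (Set (ℝ × ℝ))} {X Y : Ω → ℝ} {f g : ℝ × ℝ → ℝ}
    (hX : IsSimpleIntegral c P S X f) (hY : IsSimpleIntegral c P S Y g) :
    IsSimpleIntegral c P S (fun ω => X ω - Y ω) (fun p => f p - g p) := by
  simp_rw [sub_eq_add_neg]
  exact hX.add hY.neg

/-- The observations at the multiples of `δ` are integrals of simple functions built from a
common family of disjoint sets. -/
theorem IsCenteredField.exists_isSimpleIntegral_trawl (hc : IsCenteredField c volume P κ)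
    (ha : IsTrawlFunction a) (δ : ℝ) (M : ℕ) : ∃ S : Set (Set (ℝ × ℝ)),
    (∀ A ∈ S, MeasurableSet A ∧ volume A < ∞) ∧ S.PairwiseDisjoint id ∧
    ∀ k < M, IsSimpleIntegral c P S (c (trawlSetAt a (k * δ))) (trawlIndicator a (k * δ)) := by
  let B : Fin M → Set (ℝ × ℝ) := fun i => trawlSetAt a ((i : ℕ) * δ)
  have hB : ∀ i, MeasurableSet (B i) := fun i => measurableSet_trawlSetAt ha _
  have hB' : ∀ i, volume (B i) < ∞ := fun i => volume_trawlSetAt_lt_top ha _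
  refine ⟨range (atomOf B), ?_, pairwiseDisjoint_range_atomOf B, fun k hk =>
    hc.isSimpleIntegral_atomOf hB hB' ⟨k, hk⟩⟩
  rintro _ ⟨s, rfl⟩
  exact ⟨measurableSet_atomOf hB s, measure_atomOf_lt_top hB' s⟩

theorem monotone_natCast_mul {δ : ℝ} (hδ : 0 ≤ δ) : Monotone fun k : ℕ => (k : ℝ) * δ :=
  fun _ _ h => mul_le_mul_of_nonneg_right (Nat.cast_le.2 h) hδ

theorem sum_abs_trawlIndicator_lag_sub_le (ha : IsTrawlFunction a) {δ : ℝ} (hδ : 0 ≤ δ)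
    (l N : ℕ) (p : ℝ × ℝ) : ∑ k ∈ Finset.range N,
      |trawlIndicator a ((k + l + 1 : ℕ) * δ) p - trawlIndicator a ((k + l : ℕ) * δ) p| ≤ 2 := by
  have h := sum_abs_trawlIndicator_sub_le ha (τ := fun k : ℕ => ((k + l : ℕ) : ℝ) * δ)
    (fun i j hij => monotone_natCast_mul hδ (Nat.add_le_add_right hij l)) N p
  simpa only [Nat.add_right_comm _ 1 l] using h

theorem integral_abs_trawlIndicator_step_le (ha : IsTrawlFunction a) {δ : ℝ} (hδ : 0 ≤ δ)
    (j : ℕ) : ∫ p, |trawlIndicator a ((j + 1 : ℕ) * δ) p - trawlIndicator a (j * δ) p| ≤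
      2 * (δ * a 0) := by
  refine (integral_abs_trawlIndicator_sub_le ha (monotone_natCast_mul hδ (Nat.le_succ j))).trans
    (le_of_eq ?_)
  push_cast
  ring

/-- The variance bound with `u_k` a trawl indicator and `v_k` the increment at lag `l`; the
resulting constant does not depend on `l`, which grows with the sample. -/
theorem IsCenteredField.integral_abs_lag_sum_sub_le [IsProbabilityMeasure P]
    (hc : IsCenteredField c volume P κ)
    (ha : IsTrawlFunction a) {δ : ℝ} (hδ : 0 ≤ δ) (l N : ℕ) {Z : ℕ → Ω → ℝ}
    (hZ : ∀ k, Z k = c (trawlSetAt a (k * δ))) :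
    ∫ ω, |∑ k ∈ Finset.range N, Z k ω * (Z (k + l + 1) ω - Z (k + l) ω) -
      N * (tailIntegral a ((l + 1 : ℕ) * δ) - tailIntegral a (l * δ))| ∂P ≤
      √(N * (2 * (δ * a 0) * (2 * κ + 4 * (2 * tailIntegral a 0)))) := by
  obtain ⟨S, hS, hSd, h⟩ := hc.exists_isSimpleIntegral_trawl ha δ (N + l + 1)
  simp_rw [← hZ] at h
  have hΓ := ha.tailIntegral_nonneg le_rfl
  have hU : ∀ k < N, IsSimpleIntegral c P S (Z k) (trawlIndicator a (k * δ)) := fun k hk =>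
    h k (by omega)
  have hV : ∀ k < N, IsSimpleIntegral c P S (fun ω => Z (k + l + 1) ω - Z (k + l) ω)
      (fun p => trawlIndicator a ((k + l + 1 : ℕ) * δ) p -
        trawlIndicator a ((k + l : ℕ) * δ) p) := fun k hk =>
    (h (k + l + 1) (by omega)).sub (h (k + l) (by omega))
  have hsq := IsSimpleIntegral.integral_sum_mul_sub_sq_le (μ := volume) hc hS hSd hU hV
    -- Half of this `G` would do; the value is the one required for squared increments, so that both
    -- cases share a constant.
    (G := 2 * tailIntegral a 0) (m := 2 * (δ * a 0)) (fun k _ p => abs_trawlIndicator_le_one _ p)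
    (sum_abs_trawlIndicator_lag_sub_le ha hδ l N)
    (fun k _ => by rw [integral_abs_trawlIndicator ha]; linarith)
    (fun k _ => integral_abs_trawlIndicator_step_le ha hδ (k + l))
  have hmean : ∑ k ∈ Finset.range N, ∫ p, trawlIndicator a (k * δ) p *
      (trawlIndicator a ((k + l + 1 : ℕ) * δ) p - trawlIndicator a ((k + l : ℕ) * δ) p) =
      N * (tailIntegral a ((l + 1 : ℕ) * δ) - tailIntegral a (l * δ)) := by
    rw [Finset.sum_congr rfl fun k _ => ?_, Finset.sum_const, Finset.card_range, nsmul_eq_mul]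
    rw [integral_trawlIndicator_mul_sub ha (monotone_natCast_mul hδ (Nat.le_add_right k l))
      (monotone_natCast_mul hδ (Nat.le_succ _))]
    congr 2 <;> · push_cast; ring
  rw [hmean] at hsq
  refine integral_abs_le_sqrt (MemLp.sub ?_ (memLp_const _)) hsq
  exact memLp_finsetSum _ fun k hk => ((hU k (Finset.mem_range.1 hk)).memLp hc hS).mul_of_four
    ((hV k (Finset.mem_range.1 hk)).memLp hc hS)

/-- The variance bound with `u_k = v_k` the one-step increment. -/
theorem IsCenteredField.integral_abs_sq_sum_sub_le [IsProbabilityMeasure P]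
    (hc : IsCenteredField c volume P κ)
    (ha : IsTrawlFunction a) {δ : ℝ} (hδ : 0 ≤ δ) (N : ℕ) {Z : ℕ → Ω → ℝ}
    (hZ : ∀ k, Z k = c (trawlSetAt a (k * δ))) :
    ∫ ω, |∑ k ∈ Finset.range N, (Z (k + 1) ω - Z k ω) ^ 2 -
      N * (2 * (tailIntegral a 0 - tailIntegral a δ))| ∂P ≤
      √(N * (2 * (δ * a 0) * (2 * κ + 4 * (2 * tailIntegral a 0)))) := by
  obtain ⟨S, hS, hSd, h⟩ := hc.exists_isSimpleIntegral_trawl ha δ (N + 1)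
  simp_rw [← hZ] at h
  have hV : ∀ k < N, IsSimpleIntegral c P S (fun ω => Z (k + 1) ω - Z k ω)
      (fun p => trawlIndicator a ((k + 1 : ℕ) * δ) p - trawlIndicator a (k * δ) p) := fun k hk =>
    (h (k + 1) (by omega)).sub (h k (by omega))
  have hle : ∀ k : ℕ, (k : ℝ) * δ ≤ (k + 1 : ℕ) * δ := fun k =>
    monotone_natCast_mul hδ (Nat.le_succ k)
  have hsq := IsSimpleIntegral.integral_sum_mul_sub_sq_le (μ := volume) hc hS hSd hV hV
    (G := 2 * tailIntegral a 0) (m := 2 * (δ * a 0))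
    (fun k _ p => abs_trawlIndicator_sub_le_one _ _ p)
    (sum_abs_trawlIndicator_lag_sub_le ha hδ 0 N)
    (fun k _ => integral_abs_trawlIndicator_sub_le_tailIntegral ha (hle k))
    (fun k _ => integral_abs_trawlIndicator_step_le ha hδ k)
  have hmean : ∑ k ∈ Finset.range N, ∫ p,
      (trawlIndicator a ((k + 1 : ℕ) * δ) p - trawlIndicator a (k * δ) p) *
      (trawlIndicator a ((k + 1 : ℕ) * δ) p - trawlIndicator a (k * δ) p) =
      N * (2 * (tailIntegral a 0 - tailIntegral a δ)) := by
    rw [Finset.sum_congr rfl fun k _ => ?_, Finset.sum_const, Finset.card_range, nsmul_eq_mul]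
    rw [integral_trawlIndicator_sub_mul_self ha (hle k)]
    congr 3
    push_cast
    ring
  rw [hmean] at hsq
  simp_rw [pow_two (Z _ _ - Z _ _)]
  refine integral_abs_le_sqrt (MemLp.sub ?_ (memLp_const _)) hsq
  exact memLp_finsetSum _ fun k hk => ((hV k (Finset.mem_range.1 hk)).memLp hc hS).mul_of_four
    ((hV k (Finset.mem_range.1 hk)).memLp hc hS)

theorem IsCenteredField.integral_sq_trawl (hc : IsCenteredField c volume P κ)
    (ha : IsTrawlFunction a) (t : ℝ) :
    ∫ ω, c (trawlSetAt a t) ω ^ 2 ∂P = tailIntegral a 0 := by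
  rw [hc.second _ (measurableSet_trawlSetAt ha t) (volume_trawlSetAt_lt_top ha t), Measure.real,
    volume_trawlSetAt ha, ENNReal.toReal_ofReal (ha.tailIntegral_nonneg le_rfl)]

end LagSums

/-! ### Boundary terms of the sample autocovariances -/

section Algebra

/-- Difference of the sample autocovariances at the lags `l + 1` and `l` of `z + m`. -/
theorem sample_autocov_sub_eq (z : ℕ → ℝ) (m : ℝ) (N l : ℕ) {x : ℕ → ℝ} {xbar zbar : ℝ}
    (hx : ∀ k, x k = z k + m) (hxbar : xbar = zbar + m) :
    (∑ k ∈ Finset.range N, (x (l + 1 + k) - xbar) * (x k - xbar)) -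
      ∑ k ∈ Finset.range (N + 1), (x (l + k) - xbar) * (x k - xbar) =
    (∑ k ∈ Finset.range N, z k * (z (k + l + 1) - z (k + l))) - zbar * (z (N + l) - z l) -
      (z (N + l) - zbar) * (z N - zbar) := by
  have hd : ∀ k, x k - xbar = z k - zbar := fun k => by rw [hx, hxbar]; ring
  simp_rw [hd]
  -- The sample mean multiplies only increments in the common range of summation, and these
  -- telescope.
  have htel : ∑ k ∈ Finset.range N, zbar * (z (k + l + 1) - z (k + l)) =
      zbar * (z (N + l) - z l) := by
    rw [← Finset.mul_sum]
    have h := Finset.sum_range_sub (fun k => z (k + l)) N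
    simp only [Nat.add_right_comm _ 1 l, zero_add] at h
    rw [h]
  rw [Finset.sum_range_succ, ← sub_sub, ← Finset.sum_sub_distrib, ← htel, ← Finset.sum_sub_distrib,
    add_comm l N]
  congr 1
  refine Finset.sum_congr rfl fun k _ => ?_
  rw [show l + 1 + k = k + l + 1 by omega, add_comm l k]
  ring

/-- Only squares remain on the right; their expectations are at most `Γ(0)` for the sample mean and
for single observations. -/
theorem abs_boundary_terms_le (s x y w : ℝ) :
    |s * (x - y) + (x - s) * (w - s)| ≤ 3 * s ^ 2 + 2 * (x ^ 2 + y ^ 2 + w ^ 2) := by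
  rw [abs_le]
  constructor <;>
    nlinarith [sq_nonneg (s - x), sq_nonneg (s + x), sq_nonneg (s - y), sq_nonneg (s + y),
      sq_nonneg (x - w), sq_nonneg (x + w), sq_nonneg (w - s), sq_nonneg (w + s), sq_nonneg s,
      sq_nonneg x, sq_nonneg y, sq_nonneg w]

end Algebra

/-! ### Deterministic limits and Markov's inequality -/

section Convergence

theorem tendstoInMeasure_of_abs_sub_le {Ω : Type*} [MeasurableSpace Ω] {P : Measure Ω}
    [IsFiniteMeasure P] {F Y : ℕ → Ω → ℝ} {b : ℝ} {r : ℕ → ℝ} (hY : ∀ᶠ n in atTop, Integrable (Y n) P)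
    (hFY : ∀ᶠ n in atTop, ∀ ω, |F n ω - b| ≤ Y n ω) (hYr : ∀ᶠ n in atTop, ∫ ω, Y n ω ∂P ≤ r n)
    (hr : Tendsto r atTop (𝓝 0)) : TendstoInMeasure P F atTop fun _ => b := by
  rw [tendstoInMeasure_iff_norm]
  intro ε hε
  have hlim : Tendsto (fun n => ENNReal.ofReal (r n / ε)) atTop (𝓝 0) := by
    have := ENNReal.tendsto_ofReal (hr.div_const ε)
    simpa using this
  refine tendsto_of_tendsto_of_tendsto_of_le_of_le' tendsto_const_nhds hlim
    (Eventually.of_forall fun n => zero_le) ?_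
  filter_upwards [hY, hFY, hYr] with n h1 h2 h3
  have h0 : 0 ≤ᵐ[P] Y n := Eventually.of_forall fun ω => (abs_nonneg _).trans (h2 ω)
  have hM := mul_meas_ge_le_integral_of_nonneg h0 h1 ε
  have hle : P {ω | ε ≤ ‖F n ω - b‖} ≤ P {ω | ε ≤ Y n ω} :=
    measure_mono fun ω hω => le_trans hω (h2 ω)
  refine hle.trans ?_
  rw [← ENNReal.ofReal_toReal (measure_ne_top P {ω | ε ≤ Y n ω})]
  refine ENNReal.ofReal_le_ofReal ?_
  rw [le_div_iff₀ hε, mul_comm]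
  exact hM.trans h3

variable {a : ℝ → ℝ} {Δ : ℕ → ℝ} {t : ℝ}

theorem tendsto_natFloor_mul (hΔpos : ∀ n, 0 < Δ n) (hΔ : Tendsto Δ atTop (𝓝 0)) (ht : 0 ≤ t) :
    Tendsto (fun n => (⌊t / Δ n⌋₊ : ℝ) * Δ n) atTop (𝓝 t) := by
  have hlow : Tendsto (fun n => t - Δ n) atTop (𝓝 t) := by
    simpa using (tendsto_const_nhds (x := t)).sub hΔ
  refine tendsto_of_tendsto_of_tendsto_of_le_of_le hlow tendsto_const_nhds (fun n => ?_)
    fun n => ?_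
  · have h := Nat.lt_floor_add_one (t / Δ n)
    rw [div_lt_iff₀ (hΔpos n)] at h
    simp only
    linarith
  · exact (le_div_iff₀ (hΔpos n)).1 (Nat.floor_le (div_nonneg ht (hΔpos n).le))

theorem tendsto_natFloor_add_one_mul (hΔpos : ∀ n, 0 < Δ n) (hΔ : Tendsto Δ atTop (𝓝 0))
    (ht : 0 ≤ t) : Tendsto (fun n => ((⌊t / Δ n⌋₊ + 1 : ℕ) : ℝ) * Δ n) atTop (𝓝 t) := by
  have h := (tendsto_natFloor_mul hΔpos hΔ ht).add hΔ
  rw [add_zero] at h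
  refine h.congr fun n => ?_
  push_cast
  ring

/-- As `a` decreases, the quotient, an average of `a` over `[lΔ, (l+1)Δ]`, lies between the values
at the two endpoints, both of which tend to `a t`. -/
theorem IsTrawlFunction.tendsto_difference_quotient (ha : IsTrawlFunction a)
    (hΔpos : ∀ n, 0 < Δ n) (hΔ : Tendsto Δ atTop (𝓝 0)) (ht : 0 ≤ t) :
    Tendsto (fun n => (tailIntegral a (⌊t / Δ n⌋₊ * Δ n) -
      tailIntegral a ((⌊t / Δ n⌋₊ + 1 : ℕ) * Δ n)) / Δ n) atTop (𝓝 (a t)) := by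
  have hlim : ∀ s : ℕ → ℝ, (∀ n, 0 ≤ s n) → Tendsto s atTop (𝓝 t) →
      Tendsto (fun n => a (s n)) atTop (𝓝 (a t)) := fun s hs hst =>
    (ha.continuousOn t ht).tendsto.comp
      (tendsto_nhdsWithin_iff.2 ⟨hst, Eventually.of_forall hs⟩)
  have hpos : ∀ n, ∀ j : ℕ, 0 ≤ (j : ℝ) * Δ n := fun n j =>
    mul_nonneg j.cast_nonneg (hΔpos n).le
  refine tendsto_of_tendsto_of_tendsto_of_le_of_le
    (hlim _ (fun n => hpos n _) (tendsto_natFloor_add_one_mul hΔpos hΔ ht))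
    (hlim _ (fun n => hpos n _) (tendsto_natFloor_mul hΔpos hΔ ht)) (fun n => ?_) fun n => ?_
  · simp only
    rw [le_div_iff₀ (hΔpos n)]
    refine le_trans (le_of_eq ?_) (ha.le_tailIntegral_sub (hpos n _)
      (monotone_natCast_mul (hΔpos n).le (Nat.le_succ _)))
    push_cast
    ring
  · simp only
    rw [div_le_iff₀ (hΔpos n)]
    refine (ha.tailIntegral_sub_le (hpos n _)
      (monotone_natCast_mul (hΔpos n).le (Nat.le_succ _))).trans (le_of_eq ?_)
    push_cast
    ring

theorem tendsto_natFloor_add_one_div (hΔpos : ∀ n, 0 < Δ n) (hΔ : Tendsto Δ atTop (𝓝 0))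
    (hnΔ : Tendsto (fun n : ℕ => (n : ℝ) * Δ n) atTop atTop) (ht : 0 ≤ t) :
    Tendsto (fun n : ℕ => ((⌊t / Δ n⌋₊ + 1 : ℕ) : ℝ) / n) atTop (𝓝 0) := by
  have h := (tendsto_natFloor_add_one_mul hΔpos hΔ ht).div_atTop hnΔ
  exact h.congr fun n => mul_div_mul_right _ _ (hΔpos n).ne'

theorem eventually_natFloor_add_one_lt (hΔpos : ∀ n, 0 < Δ n) (hΔ : Tendsto Δ atTop (𝓝 0))
    (hnΔ : Tendsto (fun n : ℕ => (n : ℝ) * Δ n) atTop atTop) (ht : 0 ≤ t) :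
    ∀ᶠ n : ℕ in atTop, ⌊t / Δ n⌋₊ + 1 < n := by
  filter_upwards [(tendsto_natFloor_add_one_div hΔpos hΔ hnΔ ht).eventually_lt_const zero_lt_one,
    eventually_gt_atTop 0] with n h hn
  rw [div_lt_one (by exact_mod_cast hn)] at h
  exact_mod_cast h

/-- Losing `l + 1` of the `n` terms is harmless: `(l + 1)/n = (l + 1)Δ/(nΔ)`, where the numerator
tends to `t` and the denominator to infinity. -/
theorem tendsto_mean (ha : IsTrawlFunction a)
    (hΔpos : ∀ n, 0 < Δ n) (hΔ : Tendsto Δ atTop (𝓝 0))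
    (hnΔ : Tendsto (fun n : ℕ => (n : ℝ) * Δ n) atTop atTop) (ht : 0 ≤ t) :
    Tendsto (fun n : ℕ => 1 / (n * Δ n) * ((n - (⌊t / Δ n⌋₊ + 1) : ℕ) *
      (tailIntegral a (⌊t / Δ n⌋₊ * Δ n) - tailIntegral a ((⌊t / Δ n⌋₊ + 1 : ℕ) * Δ n))))
      atTop (𝓝 (a t)) := by
  have h := ((tendsto_const_nhds (x := (1 : ℝ))).sub
    (tendsto_natFloor_add_one_div hΔpos hΔ hnΔ ht)).mul
    (ha.tendsto_difference_quotient hΔpos hΔ ht)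
  rw [sub_zero, one_mul] at h
  refine h.congr' ?_
  filter_upwards [eventually_natFloor_add_one_lt hΔpos hΔ hnΔ ht, eventually_gt_atTop 0] with n h hn
  have hn' : (n : ℝ) ≠ 0 := by exact_mod_cast hn.ne'
  have hd := (hΔpos n).ne'
  rw [Nat.cast_sub h.le]
  field_simp

theorem tendsto_sqrt_mul_div {x : ℕ → ℝ} (hx : Tendsto x atTop atTop) (K : ℝ) :
    Tendsto (fun n => 1 / x n * √(x n * K)) atTop (𝓝 0) := by
  have h := ((tendsto_const_nhds (x := √K)).div_atTop (Real.tendsto_sqrt_atTop.comp hx))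
  refine h.congr' ?_
  filter_upwards [hx.eventually_gt_atTop 0] with n hn
  have hs : √(x n) ≠ 0 := (Real.sqrt_pos.2 hn).ne'
  rw [Real.sqrt_mul hn.le, Function.comp_apply, div_eq_iff hs]
  field_simp
  rw [Real.sq_sqrt hn.le]

end Convergence

/-! ### Consistency of the estimator -/

section Estimator

variable {Ω : Type*} [MeasurableSpace Ω] {P : Measure Ω} [IsProbabilityMeasure P]
  {c : Set (ℝ × ℝ) → Ω → ℝ} {κ : ℝ} {a : ℝ → ℝ} {X : ℝ → Ω → ℝ} {m : ℝ}

omit [MeasurableSpace Ω] in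
theorem sampleMean_eq_add (hX : ∀ t ω, X t ω = c (trawlSetAt a t) ω + m) (δ : ℝ) {n : ℕ}
    (hn : 0 < n) (ω : Ω) :
    sampleMean X δ n ω = sampleMean (fun t => c (trawlSetAt a t)) δ n ω + m := by
  have hn' : (n : ℝ) ≠ 0 := by exact_mod_cast hn.ne'
  simp only [sampleMean, hX, Finset.sum_add_distrib, Finset.sum_const, Finset.card_range,
    nsmul_eq_mul]
  rw [mul_add, ← mul_assoc _ (n : ℝ), one_div_mul_cancel hn', one_mul]

/-- Cauchy–Schwarz, with no use of decorrelation: boundedness is enough, because the term is later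
divided by `nΔ`. -/
theorem IsCenteredField.integral_sampleMean_sq_le (hc : IsCenteredField c volume P κ)
    (ha : IsTrawlFunction a) (δ : ℝ) (n : ℕ) :
    Integrable (fun ω => sampleMean (fun t => c (trawlSetAt a t)) δ n ω ^ 2) P ∧
    ∫ ω, sampleMean (fun t => c (trawlSetAt a t)) δ n ω ^ 2 ∂P ≤ tailIntegral a 0 := by
  have hL : ∀ t, MemLp (c (trawlSetAt a t)) 2 P := fun t =>
    (hc.memLp _ (measurableSet_trawlSetAt ha t) (volume_trawlSetAt_lt_top ha t)).mono_exponent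
      (by norm_num)
  have hM : MemLp (fun ω => sampleMean (fun t => c (trawlSetAt a t)) δ n ω) 2 P :=
    (memLp_finsetSum (Finset.range n) fun k _ => hL (k * δ)).const_mul (1 / (n : ℝ))
  refine ⟨hM.integrable_sq, ?_⟩
  rcases Nat.eq_zero_or_pos n with rfl | hn
  · simpa [sampleMean] using ha.tailIntegral_nonneg le_rfl
  have hn' : (0 : ℝ) < n := by exact_mod_cast hn
  have hle : ∀ ω, sampleMean (fun t => c (trawlSetAt a t)) δ n ω ^ 2 ≤
      1 / (n : ℝ) * ∑ k ∈ Finset.range n, c (trawlSetAt a (k * δ)) ω ^ 2 := fun ω => by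
    have h := sq_sum_le_card_mul_sum_sq (s := Finset.range n)
      (f := fun k : ℕ => c (trawlSetAt a (k * δ)) ω)
    rw [Finset.card_range] at h
    have h' := mul_le_mul_of_nonneg_left h (show (0 : ℝ) ≤ (1 / (n : ℝ)) ^ 2 by positivity)
    rw [sampleMean, mul_pow]
    refine h'.trans (le_of_eq ?_)
    rw [← mul_assoc]
    congr 1
    field_simp
  have hi : ∀ k ∈ Finset.range n, Integrable (fun ω => c (trawlSetAt a (k * δ)) ω ^ 2) P :=
    fun k _ => (hL _).integrable_sq
  refine (integral_mono hM.integrable_sq ((integrable_finsetSum _ hi).const_mul _) hle).trans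
    (le_of_eq ?_)
  rw [integral_const_mul, integral_finsetSum _ hi]
  simp only [hc.integral_sq_trawl ha, Finset.sum_const, Finset.card_range, nsmul_eq_mul]
  field_simp

theorem IsCenteredField.tendstoInMeasure_trawlEstimator_of_pos (hc : IsCenteredField c volume P κ)
    (ha : IsTrawlFunction a) (hX : ∀ t ω, X t ω = c (trawlSetAt a t) ω + m) {Δ : ℕ → ℝ}
    (hΔpos : ∀ n, 0 < Δ n) (hΔ : Tendsto Δ atTop (𝓝 0))
    (hnΔ : Tendsto (fun n : ℕ => (n : ℝ) * Δ n) atTop atTop) {t : ℝ} (ht : 0 < t) :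
    TendstoInMeasure P (fun (n : ℕ) (ω : Ω) => trawlEstimator X (Δ n) n t ω) atTop
      fun _ => a t := by
  let Z : ℕ → ℕ → Ω → ℝ := fun n k => c (trawlSetAt a (k * Δ n))
  let s : ℕ → Ω → ℝ := fun n => sampleMean (fun t => c (trawlSetAt a t)) (Δ n) n
  let l : ℕ → ℕ := fun n => ⌊t / Δ n⌋₊
  let N : ℕ → ℕ := fun n => n - (l n + 1)
  let e : ℕ → ℝ := fun n =>
    N n * (tailIntegral a ((l n + 1 : ℕ) * Δ n) - tailIntegral a (l n * Δ n))
  let W : ℕ → Ω → ℝ := fun n ω =>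
    ∑ k ∈ Finset.range (N n), Z n k ω * (Z n (k + l n + 1) ω - Z n (k + l n) ω)
  let R : ℕ → Ω → ℝ := fun n ω => 3 * s n ω ^ 2 +
    2 * (Z n (N n + l n) ω ^ 2 + Z n (l n) ω ^ 2 + Z n (N n) ω ^ 2)
  let μ : ℕ → ℝ := fun n => 1 / (n * Δ n) *
    (N n * (tailIntegral a (l n * Δ n) - tailIntegral a ((l n + 1 : ℕ) * Δ n)))
  set K : ℝ := 2 * a 0 * (2 * κ + 4 * (2 * tailIntegral a 0)) with hK
  have hΓ := ha.tailIntegral_nonneg le_rfl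
  have hK0 : 0 ≤ K := by
    have := ha.nonneg 0 le_rfl
    have := hc.nonneg
    positivity
  have hZ4 : ∀ n k, MemLp (Z n k) 4 P := fun n k =>
    hc.memLp _ (measurableSet_trawlSetAt ha _) (volume_trawlSetAt_lt_top ha _)
  have hZ2 : ∀ n k, Integrable (fun ω => Z n k ω ^ 2) P := fun n k =>
    ((hZ4 n k).mono_exponent (by norm_num)).integrable_sq
  have hRi : ∀ n, Integrable (R n) P := fun n =>
    ((hc.integral_sampleMean_sq_le ha (Δ n) n).1.const_mul 3).fun_add
      ((((hZ2 n _).fun_add (hZ2 n _)).fun_add (hZ2 n _)).const_mul 2)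
  -- Here `9 = 3 + 2 · 3`, each square contributing at most `Γ(0)`.
  have hR : ∀ n, ∫ ω, R n ω ∂P ≤ 9 * tailIntegral a 0 := fun n => by
    have h := hc.integral_sampleMean_sq_le ha (Δ n) n
    have hz : ∀ k, ∫ ω, Z n k ω ^ 2 ∂P = tailIntegral a 0 := fun k => hc.integral_sq_trawl ha _
    simp only [R]
    rw [integral_add (h.1.const_mul 3)
      ((((hZ2 n _).fun_add (hZ2 n _)).fun_add (hZ2 n _)).const_mul 2), integral_const_mul,
      integral_const_mul, integral_add ((hZ2 n _).fun_add (hZ2 n _)) (hZ2 n _),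
      integral_add (hZ2 n _) (hZ2 n _), hz, hz, hz]
    linarith [h.2]
  have hWi : ∀ n, Integrable (fun ω => |W n ω - e n|) P := fun n => by
    refine (Integrable.sub (integrable_finsetSum _ fun k _ => ?_) (integrable_const _)).abs
    exact ((hZ4 n k).mul_of_four ((hZ4 n _).sub (hZ4 n _))).integrable (by norm_num)
  have hW : ∀ n, ∫ ω, |W n ω - e n| ∂P ≤ √(n * Δ n * K) := fun n => by
    refine (hc.integral_abs_lag_sum_sub_le ha (hΔpos n).le (l n) (N n) (Z := Z n)
      fun k => rfl).trans (Real.sqrt_le_sqrt ?_)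
    have h1 : (N n : ℝ) * (Δ n * K) ≤ n * (Δ n * K) := mul_le_mul_of_nonneg_right
      (Nat.cast_le.2 (Nat.sub_le _ _)) (mul_nonneg (hΔpos n).le hK0)
    rw [hK] at h1 ⊢
    linarith
  have hpos : ∀ n : ℕ, (0 : ℝ) ≤ 1 / (n * Δ n) := fun n => by
    have := (hΔpos n).le
    positivity
  refine tendstoInMeasure_of_abs_sub_le
    (Y := fun n ω => 1 / (n * Δ n) * (|W n ω - e n| + R n ω) + |μ n - a t|)
    (r := fun n => 1 / (n * Δ n) * √(n * Δ n * K) + 1 / (n * Δ n) * (9 * tailIntegral a 0) +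
      |μ n - a t|)
    (Eventually.of_forall fun n => (((hWi n).fun_add (hRi n)).const_mul _).fun_add
      (integrable_const _)) ?_ (Eventually.of_forall fun n => ?_) ?_
  · filter_upwards [eventually_natFloor_add_one_lt hΔpos hΔ hnΔ ht.le] with n hn ω
    have hn0 : 0 < n := by omega
    have hn' : (n : ℝ) ≠ 0 := by exact_mod_cast hn0.ne'
    have hd := (hΔpos n).ne'
    -- The sum at lag `l` has one term more than the sum at lag `l + 1`; this needs `l < n`, true
    -- only eventually.
    have hNl : n - l n = N n + 1 := by
      simp only [N, l]
      omega
    have hest : trawlEstimator X (Δ n) n t ω - a t = -(1 / (n * Δ n)) * ((W n ω - e n) -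
        (s n ω * (Z n (N n + l n) ω - Z n (l n) ω) +
          (Z n (N n + l n) ω - s n ω) * (Z n (N n) ω - s n ω))) + (μ n - a t) := by
      have h := sample_autocov_sub_eq (fun k => Z n k ω) m (N n) (l n)
        (x := fun k => X (k * Δ n) ω) (fun k => hX _ ω)
        (sampleMean_eq_add hX (Δ n) hn0 ω)
      rw [trawlEstimator, if_neg ht.ne', sampleAutocov, sampleAutocov]
      change -(1 / Δ n) * (1 / (n : ℝ) * (∑ k ∈ Finset.range (N n),
        (X (((l n + 1 + k : ℕ) : ℝ) * Δ n) ω - sampleMean X (Δ n) n ω) *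
          (X (k * Δ n) ω - sampleMean X (Δ n) n ω)) -
        1 / (n : ℝ) * ∑ k ∈ Finset.range (n - l n),
        (X (((l n + k : ℕ) : ℝ) * Δ n) ω - sampleMean X (Δ n) n ω) *
          (X (k * Δ n) ω - sampleMean X (Δ n) n ω)) - a t = _
      rw [hNl, ← mul_sub, h]
      simp only [W, e, μ, s]
      field_simp
      ring
    have hB := abs_boundary_terms_le (s n ω) (Z n (N n + l n) ω) (Z n (l n) ω) (Z n (N n) ω)
    rw [hest]
    refine (abs_add_le _ _).trans (add_le_add_left ?_ _)
    rw [abs_mul, abs_neg, abs_of_nonneg (hpos n)]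
    exact mul_le_mul_of_nonneg_left ((abs_sub _ _).trans (add_le_add_right hB _)) (hpos n)
  · rw [integral_add (((hWi n).fun_add (hRi n)).const_mul _) (integrable_const _),
      integral_const_mul, integral_add (hWi n) (hRi n), ← mul_add]
    simp only [integral_const, probReal_univ, one_smul]
    exact add_le_add_left (mul_le_mul_of_nonneg_left (add_le_add (hW n) (hR n)) (hpos n)) _
  · have h1 := tendsto_sqrt_mul_div hnΔ K
    have h2 : Tendsto (fun n : ℕ => 1 / (n * Δ n) * (9 * tailIntegral a 0)) atTop (𝓝 0) := by
      simpa using (hnΔ.inv_tendsto_atTop).mul_const (9 * tailIntegral a 0)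
    have h3 : Tendsto (fun n => |μ n - a t|) atTop (𝓝 0) := by
      simpa [μ, N, l] using ((tendsto_mean ha hΔpos hΔ hnΔ ht.le).sub_const (a t)).abs
    simpa using (h1.add h2).add h3

theorem IsCenteredField.tendstoInMeasure_trawlEstimator_zero (hc : IsCenteredField c volume P κ)
    (ha : IsTrawlFunction a) (hX : ∀ t ω, X t ω = c (trawlSetAt a t) ω + m) {Δ : ℕ → ℝ}
    (hΔpos : ∀ n, 0 < Δ n) (hΔ : Tendsto Δ atTop (𝓝 0))
    (hnΔ : Tendsto (fun n : ℕ => (n : ℝ) * Δ n) atTop atTop) :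
    TendstoInMeasure P (fun (n : ℕ) (ω : Ω) => trawlEstimator X (Δ n) n 0 ω) atTop
      fun _ => a 0 := by
  let Z : ℕ → ℕ → Ω → ℝ := fun n k => c (trawlSetAt a (k * Δ n))
  let e : ℕ → ℝ := fun n => (n - 1 : ℕ) * (2 * (tailIntegral a 0 - tailIntegral a (Δ n)))
  let W : ℕ → Ω → ℝ := fun n ω => ∑ k ∈ Finset.range (n - 1), (Z n (k + 1) ω - Z n k ω) ^ 2
  let μ : ℕ → ℝ := fun n => 1 / (n * Δ n) *
    ((n - 1 : ℕ) * (tailIntegral a 0 - tailIntegral a (Δ n)))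
  set K : ℝ := 2 * a 0 * (2 * κ + 4 * (2 * tailIntegral a 0)) with hK
  have hΓ := ha.tailIntegral_nonneg le_rfl
  have hK0 : 0 ≤ K := by
    have := ha.nonneg 0 le_rfl
    have := hc.nonneg
    positivity
  have hZ4 : ∀ n k, MemLp (Z n k) 4 P := fun n k =>
    hc.memLp _ (measurableSet_trawlSetAt ha _) (volume_trawlSetAt_lt_top ha _)
  have hWi : ∀ n, Integrable (fun ω => |W n ω - e n|) P := fun n => by
    refine (Integrable.sub (integrable_finsetSum _ fun k _ => ?_) (integrable_const _)).abs
    exact (((hZ4 n _).sub (hZ4 n _)).mono_exponent (by norm_num)).integrable_sq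
  have hW : ∀ n, ∫ ω, |W n ω - e n| ∂P ≤ √(n * Δ n * K) := fun n => by
    refine (hc.integral_abs_sq_sum_sub_le ha (hΔpos n).le (n - 1) (Z := Z n)
      fun k => rfl).trans (Real.sqrt_le_sqrt ?_)
    have h1 : ((n - 1 : ℕ) : ℝ) * (Δ n * K) ≤ n * (Δ n * K) := mul_le_mul_of_nonneg_right
      (Nat.cast_le.2 (Nat.sub_le _ _)) (mul_nonneg (hΔpos n).le hK0)
    rw [hK] at h1 ⊢
    linarith
  have hpos : ∀ n : ℕ, (0 : ℝ) ≤ 1 / (n * Δ n) := fun n => by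
    have := (hΔpos n).le
    positivity
  refine tendstoInMeasure_of_abs_sub_le
    (Y := fun n ω => 1 / (n * Δ n) * |W n ω - e n| + |μ n - a 0|)
    (r := fun n => 1 / (n * Δ n) * √(n * Δ n * K) + |μ n - a 0|)
    (Eventually.of_forall fun n => ((hWi n).const_mul _).fun_add (integrable_const _))
    ?_ (Eventually.of_forall fun n => ?_) ?_
  · filter_upwards [eventually_gt_atTop 0] with n hn0 ω
    have hn' : (n : ℝ) ≠ 0 := by exact_mod_cast hn0.ne'
    have hd := (hΔpos n).ne'
    have hest : trawlEstimator X (Δ n) n 0 ω - a 0 =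
        1 / 2 * (1 / (n * Δ n)) * (W n ω - e n) + (μ n - a 0) := by
      rw [trawlEstimator, if_pos rfl]
      simp only [hX, add_sub_add_right_eq_sub, W, Z, e, μ]
      field_simp
      ring
    rw [hest]
    refine (abs_add_le _ _).trans (add_le_add_left ?_ _)
    rw [abs_mul, abs_mul, abs_of_nonneg (hpos n), abs_of_nonneg (by norm_num : (0 : ℝ) ≤ 1 / 2)]
    exact mul_le_mul_of_nonneg_right (mul_le_of_le_one_left (hpos n) (by norm_num)) (abs_nonneg _)
  · rw [integral_add ((hWi n).const_mul _) (integrable_const _), integral_const_mul]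
    simp only [integral_const, probReal_univ, one_smul]
    exact add_le_add_left (mul_le_mul_of_nonneg_left (hW n) (hpos n)) _
  · have h1 := tendsto_sqrt_mul_div hnΔ K
    have h3 : Tendsto (fun n => |μ n - a 0|) atTop (𝓝 0) := by
      -- At `t = 0` the lag `⌊t / Δ n⌋₊` is `0`, so the same limit of means applies.
      simpa [μ] using ((tendsto_mean ha hΔpos hΔ hnΔ le_rfl).sub_const (a 0)).abs
    simpa using h1.add h3

end Estimator

theorem mainTheorem2 {Ω Ω' : Type*} [MeasurableSpace Ω] [MeasurableSpace Ω']
    (P : Measure Ω) [IsProbabilityMeasure P] (P' : Measure Ω') [IsProbabilityMeasure P']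
    (γ b : ℝ) (ν : Measure ℝ)
    (L : Set (ℝ × ℝ) → Ω → ℝ) (hL : IsHomogeneousLevyBasis L P γ b ν)
    (L' : Ω' → ℝ) (hL' : IsLevySeed L' P' γ b ν)
    (hvar : Var[L'; P'] = 1) (hmom : Integrable (fun ω => |L' ω| ^ 4) P')
    (a : ℝ → ℝ) (ha : IsTrawlFunction a)
    (Δ : ℕ → ℝ) (hΔpos : ∀ n, 0 < Δ n) (hΔ : Tendsto Δ atTop (𝓝 0))
    (hnΔ : Tendsto (fun n : ℕ => (n : ℝ) * Δ n) atTop atTop) :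
    ∀ t : ℝ, 0 ≤ t →
      TendstoInMeasure P (fun (n : ℕ) (ω : Ω) => trawlEstimator (trawlProcess L a) (Δ n) n t ω)
        atTop (fun _ => a t) := by
  intro t ht
  have hmom' : MemLp L' 4 P' := by
    refine (integrable_norm_rpow_iff hL'.measurable.aestronglyMeasurable (by norm_num)
      (by norm_num)).1 ?_
    refine hmom.congr (Eventually.of_forall fun ω => ?_)
    simp only [Real.norm_eq_abs]
    exact_mod_cast rfl
  obtain ⟨κ, hc⟩ := hL.exists_isCenteredField hL' hvar hmom'
  -- The trawl sets all have the same area, so a single constant centers every observation.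
  have hmean : ∀ t, ∫ ω, L (trawlSetAt a t) ω ∂P = ∫ ω, L (trawlSetAt a 0) ω ∂P := fun t => by
    have hm := fun t => (hL.isLevyBasis.measurable _ (measurableSet_trawlSetAt ha t)
      (volume_trawlSetAt_lt_top ha t)).aemeasurable (μ := P)
    have h := fun t => integral_map (hm t) (f := fun x : ℝ => x) (by fun_prop)
    rw [← h t, ← h 0, hL.map_eq (measurableSet_trawlSetAt ha t) (measurableSet_trawlSetAt ha 0)
      (volume_trawlSetAt_lt_top ha t) (by rw [volume_trawlSetAt ha, volume_trawlSetAt ha])]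
  have hX : ∀ t ω, trawlProcess L a t ω = centeredField L P (trawlSetAt a t) ω +
      ∫ ω, L (trawlSetAt a 0) ω ∂P := fun t ω => by
    rw [centeredField, hmean t, sub_add_cancel]
    rfl
  rcases ht.eq_or_lt with rfl | ht'
  · exact hc.tendstoInMeasure_trawlEstimator_zero ha hX hΔpos hΔ hnΔ
  · exact hc.tendstoInMeasure_trawlEstimator_of_pos ha hX hΔpos hΔ hnΔ ht'
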